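/- Let $M$ be a smooth manifold (finite-dimensional, without boundary, Hausdorff and $\sigma$-compact), let $E\to M$ be a smooth real vector bundle of finite rank and let $\Gamma(E)$ be the space of its smooth sections. For $n\ge 0$, let $\mathrm{Der}^n(E)$ be the real vector space of multiderivations of degree $n$: the $\mathbb R$-multilinear maps $D:\Gamma(E)^{n+1}\to\Gamma(E)$ that are alternating in the first $n$ arguments, are $C^\infty(M)$-linear in each of the first $n$ arguments, and satisfy $$D(u_1,\dots,u_n,fu_{n+1})=f\,D(u_1,\dots,u_{n+1})+\sigma_D(u_1,\dots,u_n)(f)\,u_{n+1}\qquad (f\in C^\infty(M))$$ for some smooth bundle map $\sigma_D:\Lambda^nE\to TM$ (a symbol of $D$). Put $\mathrm{Der}^*(E)=\bigoplus_{n\ge0}\mathrm{Der}^n(E)$. For $p_1,\dots,p_k\ge 0$ let $\mathbb S_{(p_1,\dots,p_k)}$ be the set of unshuffles, that is, of permutations of $\{1,\dots,p_1+\dots+p_k\}$ that are increasing on each of the successive blocks of lengths $p_1,\dots,p_k$. For $D_1\in\mathrm{Der}^m(E)$ and $D_2\in\mathrm{Der}^n(E)$ put $$\begin{aligned}(D_1\circ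 D_2)(u_1,\dots,u_{m+n+1})={}&\sum_{\sigma\in\mathbb S_{(n,1,m-1)}}(-1)^\sigma D_1\big(D_2(u_{\sigma(1)},\dots,u_{\sigma(n+1)}),u_{\sigma(n+2)},\dots,u_{\sigma(m+n)},u_{m+n+1}\big)\\&+(-1)^{mn}\sum_{\sigma\in\mathbb S_{(m,n)}}(-1)^\sigma D_1\big(u_{\sigma(1)},\dots,u_{\sigma(m)},D_2(u_{\sigma(m+1)},\dots,u_{\sigma(m+n)},u_{m+n+1})\big),\end{aligned}$$ where the first sum is $0$ if $m=0$, and define the Matsushima–Nijenhuis bracket by $$[D_1,D_2]_{\mathrm{MN}}=D_1\circ D_2-(-1)^{mn}D_2\circ D_1 .$$ **Theorem.** The bracket $[D_1,D_2]_{\mathrm{MN}}$ of $D_1\in\mathrm{Der}^m(E)$ and $D_2\in\mathrm{Der}^n(E)$ lies in $\mathrm{Der}^{m+n}(E)$, and $(\mathrm{Der}^*(E),[\cdot,\cdot]_{\mathrm{MN}})$ is a graded Lie algebra: the bracket is bilinear and, for $x,y,z$ homogeneous of degrees $m,n,k$, $[x,y]=-(-1)^{mn}[y,x]$ and $[x,[y,z]]=[[x,y],z]+(-1)^{mn}[y,[x,z]]$.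 Furthermore, $\pi\in\mathrm{Der}^1(E)$ defines a left-symmetric algebroid structure on $E$ if and only if $[\pi,\pi]_{\mathrm{MN}}=0$. Here $\pi$ defines a left-symmetric algebroid structure if the product $x*y=\pi(x,y)$ on $\Gamma(E)$ satisfies $x*(y*z)-(x*y)*z=y*(x*z)-(y*x)*z$ for all $x,y,z\in\Gamma(E)$ and there is a smooth vector bundle morphism $a:E\to TM$ over the identity of $M$ (the anchor) such that $x*(fy)=f(x*y)+a(x)(f)\,y$ and $(fx)*y=f(x*y)$ for all $f\in C^\infty(M)$ and $x,y\in\Gamma(E)$. -/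

import Mathlib

open scoped Manifold ContDiff

noncomputable section

/-! ### Unshuffles and the Matsushima–Nijenhuis bracket -/

/-- `σ` is increasing on the block of positions `a, a + 1, …, b - 1` (positions start at `0`). -/
def IncreasingOnBlock {N : ℕ} (σ : Equiv.Perm (Fin N)) (a b : ℕ) : Prop :=
  ∀ i j : Fin N, a ≤ (i : ℕ) → i < j → (j : ℕ) < b → σ i < σ j

open Classical in
/-- The `(p, q, N - p - q)`-unshuffles: the permutations of `N` letters that are increasing on the
first `p` positions, on the next `q` positions, and on the remaining ones. For `N = p + q` these are
the `(p, q)`-unshuffles. -/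
def unshuffles (N p q : ℕ) : Finset (Equiv.Perm (Fin N)) :=
  Finset.univ.filter fun σ =>
    IncreasingOnBlock σ 0 p ∧ IncreasingOnBlock σ p (p + q) ∧ IncreasingOnBlock σ (p + q) N

/-- The space `Hom(Λⁿ V ⊗ V, V)`: real multilinear maps with `n + 1` arguments that are alternating
in the first `n` arguments. The last argument is kept separate: `D u v = D(u₁, …, uₙ, v)`. -/
abbrev MNCochain (V : Type*) [AddCommGroup V] [Module ℝ V] (n : ℕ) : Type _ :=
  V [⋀^Fin n]→ₗ[ℝ] (V →ₗ[ℝ] V)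

section MN

variable {V : Type*} [AddCommGroup V] [Module ℝ V]

/-- The composition `D₁ ∘ D₂` of cochains of degrees `m` and `n`, evaluated at
`(u₁, …, u_{m+n}, v)`:
`∑_{σ ∈ S(n,1,m-1)} sgn σ • D₁(D₂(u_{σ(1)}, …, u_{σ(n+1)}), u_{σ(n+2)}, …, u_{σ(m+n)}, v)`
`+ (-1)^{mn} ∑_{σ ∈ S(m,n)} sgn σ • D₁(u_{σ(1)}, …, u_{σ(m)}, D₂(u_{σ(m+1)}, …, u_{σ(m+n)}, v))`.
The first sum is empty when `m = 0`. -/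
def mnCirc {m n : ℕ} (D₁ : MNCochain V m) (D₂ : MNCochain V n)
    (u : Fin (m + n) → V) (v : V) : V :=
  (if hm : 0 < m then
    ∑ σ ∈ unshuffles (m + n) n 1,
      Equiv.Perm.sign σ •
        D₁ (fun i : Fin m =>
            if (i : ℕ) = 0 then
              D₂ (fun j : Fin n => u (σ ⟨j, by omega⟩)) (u (σ ⟨n, by omega⟩))
            else u (σ ⟨n + i, by omega⟩))
          v
   else 0) +
  (-1 : ℤ) ^ (m * n) •
    ∑ σ ∈ unshuffles (m + n) m n,
      Equiv.Perm.sign σ •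
        D₁ (fun i : Fin m => u (σ ⟨i, by omega⟩))
          (D₂ (fun j : Fin n => u (σ ⟨m + j, by omega⟩)) v)

/-- The Matsushima–Nijenhuis bracket `[D₁, D₂] = D₁ ∘ D₂ - (-1)^{mn} D₂ ∘ D₁` of cochains of
degrees `m` and `n`, evaluated at `(u₁, …, u_{m+n}, v)`. -/
def mnBracket {m n : ℕ} (D₁ : MNCochain V m) (D₂ : MNCochain V n)
    (u : Fin (m + n) → V) (v : V) : V :=
  mnCirc D₁ D₂ u v -
    (-1 : ℤ) ^ (m * n) • mnCirc D₂ D₁ (fun i => u (Fin.cast (Nat.add_comm n m) i)) v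

end MN

/-- A graded Lie algebra structure on the real graded vector space `⨁ₙ L n`: bilinear brackets
`L m × L n → L (m + n)` that are graded skew-symmetric and satisfy the graded Jacobi identity.
The two identities, whose terms lie in the same degree only up to rewriting sums of natural numbers,
are stated in the direct sum. -/
structure GradedLieStructure (L : ℕ → Type*) [∀ n, AddCommGroup (L n)] [∀ n, Module ℝ (L n)] where
  /-- the bracket of homogeneous elements -/
  bracket : ∀ m n : ℕ, L m →ₗ[ℝ] L n →ₗ[ℝ] L (m + n)
  skew : ∀ (m n : ℕ) (x : L m) (y : L n),
    DirectSum.of L (m + n) (bracket m n x y) =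
      -((-1 : ℤ) ^ (m * n) • DirectSum.of L (n + m) (bracket n m y x))
  jacobi : ∀ (m n k : ℕ) (x : L m) (y : L n) (z : L k),
    DirectSum.of L (m + (n + k)) (bracket m (n + k) x (bracket n k y z)) =
      DirectSum.of L ((m + n) + k) (bracket (m + n) k (bracket m n x y) z) +
        (-1 : ℤ) ^ (m * n) •
          DirectSum.of L (n + (m + k)) (bracket n (m + k) y (bracket m k x z))

/-! ### Multiderivations of a vector bundle and left-symmetric algebroids -/

section Bundle

variable {B : Type*} [NormedAddCommGroup B] [NormedSpace ℝ B]
  {H : Type*} [TopologicalSpace H] (I : ModelWithCorners ℝ B H)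
  {M : Type*} [TopologicalSpace M] [ChartedSpace H M] [IsManifold I ∞ M]
  (F : Type*) [NormedAddCommGroup F] [NormedSpace ℝ F]
  (E : M → Type*) [TopologicalSpace (Bundle.TotalSpace F E)] [∀ x, TopologicalSpace (E x)]
  [FiberBundle F E] [∀ x, AddCommGroup (E x)] [∀ x, Module ℝ (E x)] [VectorBundle ℝ F E]

/-- The product `f u` of a smooth function and a smooth section. -/
instance smoothFunctionSMulSection : SMul C^∞⟮I, M; 𝓘(ℝ, ℝ), ℝ⟯ Cₛ^∞⟮I; F, E⟯ where
  smul f u := ⟨fun x => f x • u x, f.contMDiff.smul_section u.contMDiff⟩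

/-- `σ` is a symbol of `D`. Here `σ` is a smooth bundle map `Λⁿ E → TM`, that is, a family of
alternating maps `E_x × ⋯ × E_x → T_x M` that turns smooth sections `u₁, …, uₙ` into a smooth vector
field `σ(u₁, …, uₙ)`, and
`D(u₁, …, uₙ, f v) = f D(u₁, …, uₙ, v) + σ(u₁, …, uₙ)(f) v`. -/
structure IsSymbol {n : ℕ} (D : MNCochain Cₛ^∞⟮I; F, E⟯ n)
    (σ : ∀ x : M, (E x) [⋀^Fin n]→ₗ[ℝ] TangentSpace I x) : Prop where
  smooth : ∀ u : Fin n → Cₛ^∞⟮I; F, E⟯,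
    ContMDiff I I.tangent ∞
      (fun x : M => (⟨x, σ x (fun i => u i x)⟩ : TangentBundle I M))
  leibniz : ∀ (u : Fin n → Cₛ^∞⟮I; F, E⟯) (v : Cₛ^∞⟮I; F, E⟯) (f : C^∞⟮I, M; 𝓘(ℝ, ℝ), ℝ⟯) (x : M),
    D u (f • v) x = f x • D u v x + mvfderiv I f x (σ x (fun i => u i x)) • v x

/-- `D ∈ Hom(Λⁿ Γ(E) ⊗ Γ(E), Γ(E))` is a multiderivation of degree `n`: it is linear over smooth
functions in each of the first `n` arguments, and a derivation with some symbol in the last one. -/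
structure IsMultiderivation {n : ℕ} (D : MNCochain Cₛ^∞⟮I; F, E⟯ n) : Prop where
  map_smul : ∀ (u : Fin n → Cₛ^∞⟮I; F, E⟯) (i : Fin n) (f : C^∞⟮I, M; 𝓘(ℝ, ℝ), ℝ⟯)
    (v : Cₛ^∞⟮I; F, E⟯), D (Function.update u i (f • u i)) v = f • D u v
  exists_symbol : ∃ σ : ∀ x : M, (E x) [⋀^Fin n]→ₗ[ℝ] TangentSpace I x, IsSymbol I F E D σ

/-- The real vector space `Derⁿ(E)` of multiderivations of degree `n` of the vector bundle `E`. -/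
def Der (n : ℕ) : Submodule ℝ (MNCochain Cₛ^∞⟮I; F, E⟯ n) where
  carrier := {D | IsMultiderivation I F E D}
  zero_mem' := by
    refine ⟨fun u i f v => ?_, fun x => 0, ⟨fun u => ?_, fun u v f x => ?_⟩⟩
    · ext x
      exact (smul_zero (f x)).symm
    · exact (Bundle.contMDiff_zeroSection ℝ (TangentSpace I : M → Type _))
    · simp
  add_mem' := by
    rintro D D' ⟨h, σ, hs, hl⟩ ⟨h', σ', hs', hl'⟩
    refine ⟨fun u i f v => ?_, fun x => σ x + σ' x, ⟨fun u => ?_, fun u v f x => ?_⟩⟩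
    · ext x
      have e : f • (D u v + D' u v) = f • D u v + f • D' u v := by
        ext y
        exact smul_add (f y) (D u v y) (D' u v y)
      simp only [AlternatingMap.add_apply, LinearMap.add_apply, h, h', e]
    · exact (hs u).add_section (hs' u)
    · simp only [AlternatingMap.add_apply, LinearMap.add_apply, ContMDiffSection.coe_add,
        Pi.add_apply, hl, hl', map_add, smul_add, add_smul]
      abel
  smul_mem' := by
    rintro c D ⟨h, σ, hs, hl⟩
    refine ⟨fun u i f v => ?_, fun x => c • σ x, ⟨fun u => ?_, fun u v f x => ?_⟩⟩
    · have e : f • (c • D u v) = c • (f • D u v) := by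
        ext y
        exact smul_comm (f y) c (D u v y)
      simp only [AlternatingMap.smul_apply, LinearMap.smul_apply, h, e]
    · exact (hs u).const_smul_section
    · simp only [AlternatingMap.smul_apply, LinearMap.smul_apply, ContMDiffSection.coe_smul,
        Pi.smul_apply, hl, map_smul, smul_add, smul_assoc]
      rw [smul_comm c (f x)]

/-- A left-symmetric algebroid structure on the vector bundle `E`: a left-symmetric algebra
structure on the space of smooth sections together with a smooth vector bundle morphism `E → TM`
over the identity (the anchor), subject to the two compatibility conditions. -/
structure LeftSymmetricAlgebroid where
  /-- the product on sections -/
  mul : Cₛ^∞⟮I; F, E⟯ →ₗ[ℝ] Cₛ^∞⟮I; F, E⟯ →ₗ[ℝ] Cₛ^∞⟮I; F, E⟯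
  /-- the associator `x(yz) - (xy)z` is symmetric in `x` and `y` -/
  left_symmetric : ∀ x y z : Cₛ^∞⟮I; F, E⟯,
    mul x (mul y z) - mul (mul x y) z = mul y (mul x z) - mul (mul y x) z
  /-- the anchor -/
  anchor : ∀ p : M, E p →ₗ[ℝ] TangentSpace I p
  anchor_smooth : ContMDiff (I.prod 𝓘(ℝ, F)) I.tangent ∞
    (fun e : Bundle.TotalSpace F E => (⟨e.1, anchor e.1 e.2⟩ : TangentBundle I M))
  leibniz : ∀ (f : C^∞⟮I, M; 𝓘(ℝ, ℝ), ℝ⟯) (x y : Cₛ^∞⟮I; F, E⟯) (p : M),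
    mul x (f • y) p = f p • mul x y p + mvfderiv I f p (anchor p (x p)) • y p
  smul_mul : ∀ (f : C^∞⟮I, M; 𝓘(ℝ, ℝ), ℝ⟯) (x y : Cₛ^∞⟮I; F, E⟯), mul (f • x) y = f • mul x y

end Bundle

end

/-! A cochain of degree `n` is encoded as a function of lists with values in `Module.End ℝ V`,
multilinear and antisymmetric in the entries and zero off length `n`; the endomorphism carries the
last argument. In this form the two sums of the Matsushima–Nijenhuis composition merge
(`mnCirc_eq_listCirc`): `listCirc X D` is the signed sum, over all splittings of the list into `a`
and `b`, of the substitutions of the endomorphism `D a` into each argument of `X b`, the last one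
included. Filling the last slot of `D` by an extracted letter is substitution in a list entry, and
the factor `(-1)^{mn}` is the sign of moving the arguments of `D` to the front.

The associator of this composition is the sum over simultaneous substitutions of two endomorphisms
in different places of `X` (`listCirc_assoc`). Such substitutions have no order, so the associator
is graded symmetric in its last two arguments: the composition is graded right pre-Lie
(`listCirc_preLie`), and the graded commutator of a pre-Lie product satisfies the graded Jacobi
identity (`listBracket_jacobi`). This part is pure algebra, valid on any real vector space.

Closure of multiderivations under the bracket has two halves. In the composition terms the values,
first-order operators with vector field symbol, enter only through their commutators, whose symbols
are Lie brackets (`listBracket_mem`). In the list entries, the compositions `D₁ ∘ D₂` and `D₂ ∘ D₁`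
both fail to be linear over functions, but the defects agree up to `(-1)^{mn}` and cancel
(`ListLinear.listBracket`). The symbol, obtained first for each tuple of sections, is tensorial and
descends to the fibres (`isMultiderivation_of_mem`).

In degree one the bracket of `π` with itself is twice `π ∘ π`, an antisymmetrised associator; its
vanishing is left symmetry, and the anchor is the symbol of `π`. -/

noncomputable section

/-! ### Signed shuffle sums over lists -/

section Shuffle

variable {α W W' : Type*} [AddCommGroup W] [AddCommGroup W']

/-- The sum of `± G a b` over all ways to split a list into two complementary sublists `a`, `b`,
with the sign of the corresponding unshuffle. -/
def shuffleSum : List α → (List α → List α → W) → W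
  | [], G => G [] []
  | x :: l, G => shuffleSum l (fun a b => G (x :: a) b) +
      shuffleSum l (fun a b => (-1 : ℤ) ^ a.length • G a (x :: b))

theorem shuffleSum_congr (l : List α) {G G' : List α → List α → W}
    (h : ∀ a b, a.length + b.length = l.length → G a b = G' a b) :
    shuffleSum l G = shuffleSum l G' := by
  induction l generalizing G G' with
  | nil => exact h [] [] rfl
  | cons x l ih =>
    simp only [shuffleSum]
    congr 1
    · exact ih fun a b hab => h _ _ (by simp; omega)
    · exact ih fun a b hab => by rw [h _ _ (by simp; omega)]

theorem shuffleSum_add (l : List α) (G G' : List α → List α → W) :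
    shuffleSum l (fun a b => G a b + G' a b) = shuffleSum l G + shuffleSum l G' := by
  induction l generalizing G G' with
  | nil => rfl
  | cons x l ih =>
    simp only [shuffleSum, smul_add, ih]
    abel

theorem map_shuffleSum (φ : W →+ W') (l : List α) (G : List α → List α → W) :
    φ (shuffleSum l G) = shuffleSum l (fun a b => φ (G a b)) := by
  induction l generalizing G with
  | nil => rfl
  | cons x l ih => simp only [shuffleSum, map_add, ih, map_zsmul]

theorem shuffleSum_zsmul (c : ℤ) (l : List α) (G : List α → List α → W) :
    shuffleSum l (fun a b => c • G a b) = c • shuffleSum l G :=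
  (map_shuffleSum (zsmulAddGroupHom c) l G).symm

theorem shuffleSum_smul {R : Type*} [Monoid R] [DistribMulAction R W] (c : R) (l : List α)
    (G : List α → List α → W) :
    shuffleSum l (fun a b => c • G a b) = c • shuffleSum l G :=
  (map_shuffleSum (DistribSMul.toAddMonoidHom W c) l G).symm

theorem shuffleSum_neg (l : List α) (G : List α → List α → W) :
    shuffleSum l (fun a b => -G a b) = -shuffleSum l G :=
  (map_shuffleSum (negAddMonoidHom) l G).symm

theorem shuffleSum_sub (l : List α) (G G' : List α → List α → W) :
    shuffleSum l (fun a b => G a b - G' a b) = shuffleSum l G - shuffleSum l G' := by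
  simp only [sub_eq_add_neg, shuffleSum_add, shuffleSum_neg]

theorem shuffleSum_zero (l : List α) : shuffleSum l (fun _ _ => (0 : W)) = 0 := by
  induction l with
  | nil => rfl
  | cons x l ih => simp [shuffleSum, ih]

theorem shuffleSum_mem {S : Type*} [SetLike S W] [AddSubgroupClass S W] (s : S) (l : List α)
    {G : List α → List α → W} (h : ∀ a b, G a b ∈ s) : shuffleSum l G ∈ s := by
  induction l generalizing G with
  | nil => exact h _ _
  | cons x l ih => exact add_mem (ih fun a b => h _ _) (ih fun a b => zsmul_mem (h _ _) _)

/-- Graded cocommutativity of unshuffling: exchanging the sublists moves each entry of one past each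
entry of the other. -/
theorem shuffleSum_comm (l : List α) (G : List α → List α → W) :
    shuffleSum l G = shuffleSum l (fun a b => (-1 : ℤ) ^ (a.length * b.length) • G b a) := by
  induction l generalizing G with
  | nil => simp [shuffleSum]
  | cons x l ih =>
    simp only [shuffleSum]
    rw [ih, add_comm, ih]
    congr 1
    · refine shuffleSum_congr l fun a b _ => ?_
      rw [smul_smul, ← pow_add, List.length_cons]
      congr 2; ring
    · refine shuffleSum_congr l fun a b _ => ?_
      rw [smul_smul, ← pow_add, List.length_cons, show a.length + a.length * (b.length + 1) =
        a.length * b.length + 2 * a.length by ring, pow_add _ _ (2 * _), pow_mul]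
      simp

/-- Coassociativity of unshuffling: both sides run over the splittings into three sublists, with the
same signs. -/
theorem shuffleSum_assoc (l : List α) (G : List α → List α → List α → W) :
    shuffleSum l (fun a m => shuffleSum m (G a)) =
      shuffleSum l (fun m c => shuffleSum m (fun a b => G a b c)) := by
  induction l generalizing G with
  | nil => rfl
  | cons x l ih =>
    simp only [shuffleSum, smul_add, shuffleSum_add]
    rw [ih, add_assoc]
    congr 1
    simp only [← shuffleSum_zsmul]
    rw [ih, ih]
    congr 1
    refine shuffleSum_congr l fun m c _ => shuffleSum_congr m fun a b h => ?_
    rw [smul_smul, ← pow_add, h]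

/-- If `G a b` vanishes for nonempty `a`, then only the splitting with empty `a` contributes. -/
theorem shuffleSum_of_left_nil (l : List α) {G : List α → List α → W}
    (h : ∀ x a b, G (x :: a) b = 0) : shuffleSum l G = G [] l := by
  induction l generalizing G with
  | nil => rfl
  | cons x l ih =>
    simp only [shuffleSum, h, shuffleSum_zero, zero_add]
    rw [ih fun y a b => by rw [h, smul_zero]]
    simp

/-- If `G a b` vanishes for nonempty `b`, then only the splitting with empty `b` contributes. -/
theorem shuffleSum_of_right_nil (l : List α) {G : List α → List α → W}
    (h : ∀ a x b, G a (x :: b) = 0) : shuffleSum l G = G l [] := by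
  induction l generalizing G with
  | nil => rfl
  | cons x l ih =>
    simp only [shuffleSum, h, smul_zero, shuffleSum_zero, add_zero]
    exact ih fun a y b => h _ _ _

end Shuffle

/-! ### Substitution derivations -/

section Subst

variable {α W W' : Type*} [AddCommGroup W] [AddCommGroup W']

/-- `∑ᵢ f(x₁, …, φ xᵢ, …, xₙ)`. -/
def substSum (φ : α → α) : List α → (List α → W) → W
  | [], _ => 0
  | x :: l, f => f (φ x :: l) + substSum φ l (fun a => f (x :: a))

theorem substSum_add (φ : α → α) (l : List α) (f g : List α → W) :
    substSum φ l (fun a => f a + g a) = substSum φ l f + substSum φ l g := by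
  induction l generalizing f g with
  | nil => simp [substSum]
  | cons x l ih => simp only [substSum, ih]; abel

theorem map_substSum (T : W →+ W') (φ : α → α) (l : List α) (f : List α → W) :
    T (substSum φ l f) = substSum φ l (fun a => T (f a)) := by
  induction l generalizing f with
  | nil => simp [substSum]
  | cons x l ih => simp only [substSum, map_add, ih]

theorem substSum_zsmul (c : ℤ) (φ : α → α) (l : List α) (f : List α → W) :
    substSum φ l (fun a => c • f a) = c • substSum φ l f :=
  (map_substSum (zsmulAddGroupHom c) φ l f).symm

theorem substSum_smul {R : Type*} [Monoid R] [DistribMulAction R W] (c : R) (φ : α → α)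
    (l : List α) (f : List α → W) :
    substSum φ l (fun a => c • f a) = c • substSum φ l f :=
  (map_substSum (DistribSMul.toAddMonoidHom W c) φ l f).symm

theorem substSum_neg (φ : α → α) (l : List α) (f : List α → W) :
    substSum φ l (fun a => -f a) = -substSum φ l f :=
  (map_substSum (negAddMonoidHom) φ l f).symm

theorem substSum_congr (φ : α → α) (l : List α) {f g : List α → W}
    (h : ∀ a, a.length = l.length → f a = g a) : substSum φ l f = substSum φ l g := by
  induction l generalizing f g with
  | nil => rfl
  | cons x l ih =>
    simp only [substSum]
    rw [h _ (by simp), ih fun a ha => h _ (by simp [ha])]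

theorem substSum_mem {S : Type*} [SetLike S W] [AddSubgroupClass S W] (s : S) (φ : α → α)
    (l : List α) {f : List α → W} (h : ∀ a, f a ∈ s) : substSum φ l f ∈ s := by
  induction l generalizing f with
  | nil => exact zero_mem s
  | cons x l ih => exact add_mem (h _) (ih fun a => h _)

/-- Each place lies in exactly one of the two sublists, and substitution preserves lengths, hence
signs. -/
theorem substSum_shuffleSum (φ : α → α) (l : List α) (G : List α → List α → W) :
    substSum φ l (fun a => shuffleSum a G) =
      shuffleSum l (fun a b =>
        substSum φ a (fun a' => G a' b) + substSum φ b (fun b' => G a b')) := by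
  induction l generalizing G with
  | nil => simp [substSum, shuffleSum]
  | cons x l ih =>
    simp only [substSum, shuffleSum, substSum_add, ih, shuffleSum_add, substSum_zsmul, smul_add]
    have e : shuffleSum l (fun a b => substSum φ a fun a' => (-1 : ℤ) ^ a'.length • G a' (x :: b)) =
        shuffleSum l (fun a b => (-1 : ℤ) ^ a.length • substSum φ a fun a' => G a' (x :: b)) := by
      refine shuffleSum_congr l fun a b _ => ?_
      rw [← substSum_zsmul]
      exact substSum_congr φ a fun a' ha => by rw [ha]
    rw [e]
    abel

/-- The difference of both sides is the sum over all simultaneous substitutions of `φ` and `ψ` in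
two different places. -/
theorem substSum_substSum_symm (φ ψ : α → α) (l : List α) (f : List α → W) :
    substSum φ l (fun a => substSum ψ a f) + substSum (φ ∘ ψ) l f =
      substSum ψ l (fun a => substSum φ a f) + substSum (ψ ∘ φ) l f := by
  induction l generalizing f with
  | nil => rfl
  | cons x l ih =>
    simp only [substSum, substSum_add, Function.comp_apply]
    have := ih (fun a => f (x :: a))
    rw [← sub_eq_zero] at this ⊢
    rw [← this]
    abel

end Subst

/-! ### Alternating multilinear functions of lists -/

section ListAlternating

variable {V W W' : Type*} [AddCommGroup V] [Module ℝ V] [AddCommGroup W] [Module ℝ W]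
  [AddCommGroup W'] [Module ℝ W']

/-- A function of lists that is multilinear and antisymmetric in the entries of the list. -/
structure ListAlternating (f : List V → W) : Prop where
  add : ∀ p x y l, f (p ++ (x + y) :: l) = f (p ++ x :: l) + f (p ++ y :: l)
  smul : ∀ p (c : ℝ) x l, f (p ++ (c • x) :: l) = c • f (p ++ x :: l)
  swap : ∀ p x y l, f (p ++ x :: y :: l) = -f (p ++ y :: x :: l)

namespace ListAlternating

variable {f g : List V → W}

theorem cons (hf : ListAlternating f) (x : V) : ListAlternating (fun l => f (x :: l)) :=
  ⟨fun p => hf.add (x :: p), fun p => hf.smul (x :: p), fun p => hf.swap (x :: p)⟩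

theorem add_cons (hf : ListAlternating f) (x y : V) (l : List V) :
    f ((x + y) :: l) = f (x :: l) + f (y :: l) := hf.add [] x y l

theorem smul_cons (hf : ListAlternating f) (c : ℝ) (x : V) (l : List V) :
    f ((c • x) :: l) = c • f (x :: l) := hf.smul [] c x l

theorem swap_cons (hf : ListAlternating f) (x y : V) (l : List V) :
    f (x :: y :: l) = -f (y :: x :: l) := hf.swap [] x y l

theorem map (hf : ListAlternating f) (T : W →ₗ[ℝ] W') : ListAlternating (fun l => T (f l)) :=
  ⟨fun p x y l => by rw [hf.add, map_add], fun p c x l => by rw [hf.smul, map_smul],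
    fun p x y l => by rw [hf.swap, map_neg]⟩

theorem add_fun (hf : ListAlternating f) (hg : ListAlternating g) :
    ListAlternating (fun l => f l + g l) :=
  ⟨fun p x y l => by rw [hf.add, hg.add]; abel,
    fun p c x l => by rw [hf.smul, hg.smul, smul_add],
    fun p x y l => by rw [hf.swap, hg.swap, neg_add]⟩

theorem zsmul_fun (hf : ListAlternating f) (c : ℤ) : ListAlternating (fun l => c • f l) :=
  ⟨fun p x y l => by rw [hf.add, smul_add],
    fun p r x l => by rw [hf.smul, smul_comm],
    fun p x y l => by rw [hf.swap, smul_neg]⟩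

theorem sub_fun (hf : ListAlternating f) (hg : ListAlternating g) :
    ListAlternating (fun l => f l - g l) := by
  have := hf.add_fun (hg.zsmul_fun (-1))
  simpa only [neg_smul, one_smul, ← sub_eq_add_neg] using this

/-- Covers the sign `(-1) ^ a.length` in the recursion of `shuffleSum`: none of the three axioms
changes the length of a list. -/
theorem length_zsmul (hf : ListAlternating f) (c : ℕ → ℤ) :
    ListAlternating (fun l => c l.length • f l) :=
  ⟨fun p x y l => by rw [hf.add, smul_add]; simp,
    fun p r x l => by rw [hf.smul, smul_comm]; simp,
    fun p x y l => by rw [hf.swap, smul_neg]; simp⟩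

theorem eq_zero_of_repeat (hf : ListAlternating f) (p : List V) (x : V) (s t : List V) :
    f (p ++ x :: (s ++ x :: t)) = 0 := by
  induction s generalizing p with
  | nil =>
    have h := hf.swap p x x t
    have h2 : (2 : ℝ) • f (p ++ x :: x :: t) = 0 := by
      rw [two_smul]; nth_rewrite 1 [h]; simp
    simpa using h2
  | cons y s ih =>
    have h := hf.swap p x y (s ++ x :: t)
    have h2 := ih (p ++ [y])
    simp only [List.append_assoc, List.cons_append, List.nil_append] at h2
    rw [List.cons_append, h, h2, neg_zero]

theorem eq_zero_of_not_nodup (hf : ListAlternating f) {l : List V} (hl : ¬ l.Nodup) : f l = 0 := by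
  obtain ⟨x, hx⟩ := List.exists_duplicate_iff_not_nodup.2 hl
  rw [List.duplicate_iff_sublist] at hx
  obtain ⟨p, r, rfl, hp, hr⟩ := List.cons_sublist_iff.1 hx
  obtain ⟨p, s, rfl⟩ := List.append_of_mem hp
  obtain ⟨s', t, rfl⟩ := List.append_of_mem (List.singleton_sublist.1 hr)
  simpa using hf.eq_zero_of_repeat p x (s ++ s') t

/-- Two adjacent entries lie in the same sublist, where `G` is antisymmetric, or in different ones;
then the swap exchanges two splittings of opposite sign. -/
theorem shuffleSum {G : List V → List V → W} (h₁ : ∀ b, ListAlternating (fun a => G a b))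
    (h₂ : ∀ a, ListAlternating (G a)) : ListAlternating (fun l => shuffleSum l G) := by
  refine ⟨fun p x y l => ?_, fun p c x l => ?_, fun p x y l => ?_⟩
  · induction p generalizing G with
    | nil =>
      simp only [List.nil_append, _root_.shuffleSum, (h₁ _).add_cons, (h₂ _).add_cons,
        shuffleSum_add, smul_add]
      abel
    | cons z p ih =>
      simp only [List.cons_append, _root_.shuffleSum]
      rw [ih (fun b => (h₁ b).cons z) fun a => h₂ _,
        ih (fun b => (h₁ (z :: b)).length_zsmul _) fun a => ((h₂ a).cons z).zsmul_fun _]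
      abel
  · induction p generalizing G with
    | nil =>
      simp only [List.nil_append, _root_.shuffleSum, (h₁ _).smul_cons, (h₂ _).smul_cons,
        shuffleSum_smul, smul_add, smul_comm _ c]
    | cons z p ih =>
      simp only [List.cons_append, _root_.shuffleSum]
      rw [ih (fun b => (h₁ b).cons z) fun a => h₂ _,
        ih (fun b => (h₁ (z :: b)).length_zsmul _) fun a => ((h₂ a).cons z).zsmul_fun _, smul_add]
  · induction p generalizing G with
    | nil =>
      simp only [List.nil_append, _root_.shuffleSum, List.length_cons, pow_succ, mul_neg, mul_one,
        neg_smul, shuffleSum_neg, (h₁ _).swap_cons y x, (h₂ _).swap_cons y x, smul_neg]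
      abel
    | cons z p ih =>
      simp only [List.cons_append, _root_.shuffleSum]
      rw [ih (fun b => (h₁ b).cons z) fun a => h₂ _,
        ih (fun b => (h₁ (z :: b)).length_zsmul _) fun a => ((h₂ a).cons z).zsmul_fun _]
      abel

theorem substSum (hf : ListAlternating f) (φ : Module.End ℝ V) :
    ListAlternating (fun l => substSum φ l f) := by
  refine ⟨fun p x y l => ?_, fun p c x l => ?_, fun p x y l => ?_⟩
  · induction p generalizing f with
    | nil =>
      simp only [List.nil_append, _root_.substSum, map_add, hf.add_cons, substSum_add]
      abel
    | cons z p ih =>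
      simp only [List.cons_append, _root_.substSum]
      rw [(hf.cons _).add, ih (hf.cons z)]
      abel
  · induction p generalizing f with
    | nil =>
      simp only [List.nil_append, _root_.substSum, map_smul, hf.smul_cons, substSum_smul, smul_add]
    | cons z p ih =>
      simp only [List.cons_append, _root_.substSum]
      rw [(hf.cons _).smul, ih (hf.cons z), smul_add]
  · induction p generalizing f with
    | nil =>
      simp only [List.nil_append, _root_.substSum, hf.swap_cons y, substSum_neg]
      rw [hf.swap_cons (φ x), hf.swap_cons (φ y)]
      abel
    | cons z p ih =>
      simp only [List.cons_append, _root_.substSum]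
      rw [(hf.cons _).swap, ih (hf.cons z)]
      abel

theorem substSum_add_left (hf : ListAlternating f) (φ ψ : Module.End ℝ V) (l : List V) :
    _root_.substSum (φ + ψ) l f = _root_.substSum φ l f + _root_.substSum ψ l f := by
  induction l generalizing f with
  | nil => simp [_root_.substSum]
  | cons x l ih =>
    simp only [_root_.substSum, LinearMap.add_apply, hf.add_cons, ih (hf.cons x)]
    abel

theorem substSum_smul_left (hf : ListAlternating f) (c : ℝ) (φ : Module.End ℝ V) (l : List V) :
    _root_.substSum (c • φ) l f = c • _root_.substSum φ l f := by
  induction l generalizing f with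
  | nil => simp [_root_.substSum]
  | cons x l ih =>
    simp only [_root_.substSum, LinearMap.smul_apply, hf.smul_cons, ih (hf.cons x), smul_add]

/-- Summing `f(φ w, c)` over all ways to extract one entry `w` from a list amounts to substituting
`φ` in all places. -/
theorem shuffleSum_extract (hf : ListAlternating f) (φ : V → V) (l : List V) :
    _root_.shuffleSum l (fun b c => match b with
      | [w] => f (φ w :: c)
      | _ => 0) = _root_.substSum φ l f := by
  induction l generalizing f with
  | nil => rfl
  | cons x l ih =>
    simp only [_root_.shuffleSum, _root_.substSum]
    congr 1
    · rw [shuffleSum_of_left_nil]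
      intros; rfl
    · rw [← ih (hf.cons x)]
      refine shuffleSum_congr l fun b c _ => ?_
      match b with
      | [] => simp
      | [w] => simp [hf.swap_cons x]
      | _ :: _ :: _ => simp

end ListAlternating

end ListAlternating

/-! ### The composition of list cochains and its graded pre-Lie identity -/

section ListComposition

variable {V : Type*} [AddCommGroup V] [Module ℝ V]

/-- The substitution of `φ` in all arguments of `X`, including the last one. -/
def substEnd (X : List V → Module.End ℝ V) (b : List V) (φ : Module.End ℝ V) : Module.End ℝ V :=
  substSum φ b X + X b * φ

theorem substEnd_add {X : List V → Module.End ℝ V} (hX : ListAlternating X) (b : List V)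
    (φ ψ : Module.End ℝ V) : substEnd X b (φ + ψ) = substEnd X b φ + substEnd X b ψ := by
  simp only [substEnd, hX.substSum_add_left, mul_add]
  abel

theorem substEnd_smul {X : List V → Module.End ℝ V} (hX : ListAlternating X) (b : List V)
    (c : ℝ) (φ : Module.End ℝ V) : substEnd X b (c • φ) = c • substEnd X b φ := by
  simp only [substEnd, hX.substSum_smul_left, mul_smul_comm, smul_add]

/-- `substEnd` as a linear map in the endomorphism. -/
def substEndLinear {X : List V → Module.End ℝ V} (hX : ListAlternating X) (b : List V) :
    Module.End ℝ V →ₗ[ℝ] Module.End ℝ V where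
  toFun := substEnd X b
  map_add' := substEnd_add hX b
  map_smul' := substEnd_smul hX b

theorem substEnd_zero (X : List V → Module.End ℝ V) (hX : ListAlternating X) (b : List V) :
    substEnd X b 0 = 0 := (substEndLinear hX b).map_zero

theorem substEnd_add_left (X Y : List V → Module.End ℝ V) (b : List V) (φ : Module.End ℝ V) :
    substEnd (fun l => X l + Y l) b φ = substEnd X b φ + substEnd Y b φ := by
  simp only [substEnd, substSum_add, add_mul]
  abel

theorem substEnd_zsmul_left (c : ℤ) (X : List V → Module.End ℝ V) (b : List V)
    (φ : Module.End ℝ V) : substEnd (fun l => c • X l) b φ = c • substEnd X b φ := by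
  simp only [substEnd, substSum_zsmul, smul_mul_assoc, smul_add]

theorem substEnd_smul_left (c : ℝ) (X : List V → Module.End ℝ V) (b : List V)
    (φ : Module.End ℝ V) : substEnd (fun l => c • X l) b φ = c • substEnd X b φ := by
  simp only [substEnd, substSum_smul, smul_mul_assoc, smul_add]

/-- Simultaneous substitution of `φ` and `ψ` in two different places. -/
def substTwo (X : List V → Module.End ℝ V) (b : List V) (φ ψ : Module.End ℝ V) :
    Module.End ℝ V :=
  substEnd (fun b' => substEnd X b' ψ) b φ - substEnd X b (ψ * φ)

/-- The order of substitution matters only when both hit the same place, and these terms are what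
the subtracted `ψ * φ` removes. -/
theorem substTwo_symm (X : List V → Module.End ℝ V) (b : List V) (φ ψ : Module.End ℝ V) :
    substTwo X b φ ψ = substTwo X b ψ φ := by
  have h := substSum_substSum_symm φ ψ b X
  have hm : ∀ ρ τ : Module.End ℝ V, substSum ρ b (fun b' => X b' * τ) = substSum ρ b X * τ :=
    fun ρ τ => (map_substSum (AddMonoidHom.mulRight τ) ρ b X).symm
  simp only [substTwo, substEnd, substSum_add, hm, add_mul, Module.End.coe_mul, mul_assoc]
  rw [← sub_eq_zero] at h ⊢
  rw [← h]
  abel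

/-- The composition `X ∘ D` of list cochains. -/
def listCirc (X D : List V → Module.End ℝ V) (l : List V) : Module.End ℝ V :=
  shuffleSum l (fun a b => substEnd X b (D a))

theorem ListAlternating.substEnd_left {X : List V → Module.End ℝ V} (hX : ListAlternating X)
    (φ : Module.End ℝ V) : ListAlternating (fun b => substEnd X b φ) :=
  (hX.substSum φ).add_fun (hX.map (LinearMap.mulRight ℝ φ))

theorem ListAlternating.listCirc {X D : List V → Module.End ℝ V} (hX : ListAlternating X)
    (hD : ListAlternating D) : ListAlternating (listCirc X D) :=
  ListAlternating.shuffleSum (fun b => hD.map (substEndLinear hX b)) fun a => hX.substEnd_left (D a)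

theorem listCirc_add_left (X Y D : List V → Module.End ℝ V) :
    listCirc (fun l => X l + Y l) D = fun l => listCirc X D l + listCirc Y D l := by
  ext1 l
  simp only [listCirc, substEnd_add_left, shuffleSum_add]

theorem listCirc_zsmul_left (c : ℤ) (X D : List V → Module.End ℝ V) :
    listCirc (fun l => c • X l) D = fun l => c • listCirc X D l := by
  ext1 l
  simp only [listCirc, substEnd_zsmul_left, shuffleSum_zsmul]

theorem listCirc_smul_left (c : ℝ) (X D : List V → Module.End ℝ V) :
    listCirc (fun l => c • X l) D = fun l => c • listCirc X D l := by
  ext1 l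
  simp only [listCirc, substEnd_smul_left, shuffleSum_smul]

theorem listCirc_add_right {X : List V → Module.End ℝ V} (hX : ListAlternating X)
    (D E : List V → Module.End ℝ V) :
    listCirc X (fun l => D l + E l) = fun l => listCirc X D l + listCirc X E l := by
  ext1 l
  simp only [listCirc, substEnd_add hX, shuffleSum_add]

theorem listCirc_zsmul_right {X : List V → Module.End ℝ V} (hX : ListAlternating X) (c : ℤ)
    (D : List V → Module.End ℝ V) :
    listCirc X (fun l => c • D l) = fun l => c • listCirc X D l := by
  ext1 l
  simp only [listCirc, ← shuffleSum_zsmul]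
  exact shuffleSum_congr l fun a b _ => map_zsmul (substEndLinear hX b) c (D a)

theorem listCirc_smul_right {X : List V → Module.End ℝ V} (hX : ListAlternating X) (c : ℝ)
    (D : List V → Module.End ℝ V) :
    listCirc X (fun l => c • D l) = fun l => c • listCirc X D l := by
  ext1 l
  simp only [listCirc, substEnd_smul hX, shuffleSum_smul]

/-- `φ` hits either one of the list entries `a` consumed by `D`, or an entry of `b` or the last
slot. The second case is an iterated substitution in `X`, including `D a` applied after `φ` in the
same place. -/
theorem substEnd_listCirc {X : List V → Module.End ℝ V} (hX : ListAlternating X)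
    (D : List V → Module.End ℝ V) (l : List V) (φ : Module.End ℝ V) :
    substEnd (listCirc X D) l φ =
      shuffleSum l (fun a b => substEnd X b (substSum φ a D) +
        substEnd (fun b' => substEnd X b' (D a)) b φ) := by
  have hl : listCirc X D l * φ = shuffleSum l (fun a b => substEnd X b (D a) * φ) :=
    map_shuffleSum (AddMonoidHom.mulRight φ) l _
  have hs : substSum φ l (listCirc X D) = _ :=
    substSum_shuffleSum φ l (fun a b => substEnd X b (D a))
  rw [substEnd, hs, hl, ← shuffleSum_add]
  refine shuffleSum_congr l fun a b _ => ?_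
  have := map_substSum (substEndLinear hX b).toAddMonoidHom φ a D
  change substEnd X b (substSum φ a D) = substSum φ a fun a' => substEnd X b (D a') at this
  rw [this, add_assoc]
  rfl

/-- The associator of the composition is a sum over simultaneous substitutions. -/
theorem listCirc_assoc {X : List V → Module.End ℝ V} (hX : ListAlternating X)
    {D : List V → Module.End ℝ V} (E : List V → Module.End ℝ V) (l : List V) :
    listCirc (listCirc X D) E l - listCirc X (listCirc D E) l =
      shuffleSum l (fun m c => shuffleSum m (fun a b => substTwo X c (E a) (D b))) := by
  have h₁ : listCirc (listCirc X D) E l = shuffleSum l (fun m c => shuffleSum m (fun a b =>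
      substEnd X c (substSum (E a) b D) + substEnd (fun c' => substEnd X c' (D b)) c (E a))) := by
    rw [← shuffleSum_assoc]
    exact shuffleSum_congr l fun a r _ => substEnd_listCirc hX D r (E a)
  have h₂ : listCirc X (listCirc D E) l = shuffleSum l (fun m c => shuffleSum m (fun a b =>
      substEnd X c (substSum (E a) b D) + substEnd X c (D b * E a))) := by
    refine shuffleSum_congr l fun m c _ => ?_
    have := map_shuffleSum (substEndLinear hX c).toAddMonoidHom m (fun a b => substEnd D b (E a))
    refine this.trans (shuffleSum_congr m fun a b _ => ?_)
    exact substEnd_add hX c _ _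
  rw [h₁, h₂, ← shuffleSum_sub]
  refine shuffleSum_congr l fun m c _ => ?_
  rw [← shuffleSum_sub]
  refine shuffleSum_congr m fun a b _ => ?_
  rw [substTwo]
  abel

/-- A list cochain that vanishes on all lists whose length is not `n`. -/
def ListHomogeneous (n : ℕ) (D : List V → Module.End ℝ V) : Prop :=
  ∀ l, l.length ≠ n → D l = 0

theorem ListHomogeneous.listCirc {m n : ℕ} {X D : List V → Module.End ℝ V}
    (hXa : ListAlternating X) (hX : ListHomogeneous m X) (hD : ListHomogeneous n D) :
    ListHomogeneous (m + n) (listCirc X D) := by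
  intro l hl
  rw [_root_.listCirc, shuffleSum_congr l (G' := fun _ _ => 0), shuffleSum_zero]
  intro a b hab
  by_cases ha : a.length = n
  · have hb : b.length ≠ m := by omega
    rw [substEnd, hX b hb, zero_mul, add_zero,
      substSum_congr (g := fun _ => (0 : ℤ) • (0 : Module.End ℝ V)), substSum_zsmul, zero_smul]
    intro b' hb'
    rw [hX b' (by omega), smul_zero]
  · rw [hD a ha, substEnd_zero X hXa]

/-- The graded right pre-Lie identity. -/
theorem listCirc_preLie {n k : ℕ} {X D E : List V → Module.End ℝ V} (hX : ListAlternating X)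
    (hDn : ListHomogeneous n D) (hEk : ListHomogeneous k E) (l : List V) :
    listCirc (listCirc X D) E l - listCirc X (listCirc D E) l =
      (-1 : ℤ) ^ (n * k) • (listCirc (listCirc X E) D l - listCirc X (listCirc E D) l) := by
  have hz : ∀ c (φ : Module.End ℝ V), substTwo X c φ 0 = 0 := by
    intro c φ
    have : (fun b' => substEnd X b' 0) = fun _ => 0 := funext fun b' => substEnd_zero X hX b'
    rw [substTwo, this, zero_mul, substEnd_zero X hX, sub_zero, substEnd, zero_mul, add_zero]
    simpa using substSum_zsmul (0 : ℤ) φ c (fun _ => (0 : Module.End ℝ V))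
  rw [listCirc_assoc hX, listCirc_assoc hX, ← shuffleSum_zsmul]
  refine shuffleSum_congr l fun m c _ => ?_
  -- The exchange produces `(-1)^{|a||b|}`, which is `(-1)^{nk}` on the only lengths where `D a` and
  -- `E b` can both be nonzero.
  rw [shuffleSum_comm, ← shuffleSum_zsmul]
  refine shuffleSum_congr m fun a b _ => ?_
  rw [substTwo_symm]
  by_cases ha : a.length = n
  · by_cases hb : b.length = k
    · rw [ha, hb]
    · rw [hEk b hb, hz, smul_zero, smul_zero]
  · rw [hDn a ha, substTwo_symm, hz, smul_zero, smul_zero]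

/-- The bracket `X ∘ D - (-1)^{mn} D ∘ X` of list cochains of degrees `m` and `n`. -/
def listBracket (m n : ℕ) (X D : List V → Module.End ℝ V) (l : List V) : Module.End ℝ V :=
  listCirc X D l - (-1 : ℤ) ^ (m * n) • listCirc D X l

theorem ListAlternating.listBracket {m n : ℕ} {X D : List V → Module.End ℝ V}
    (hX : ListAlternating X) (hD : ListAlternating D) : ListAlternating (listBracket m n X D) :=
  (hX.listCirc hD).sub_fun ((hD.listCirc hX).zsmul_fun _)

theorem ListHomogeneous.listBracket {m n : ℕ} {X D : List V → Module.End ℝ V}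
    (hXa : ListAlternating X) (hDa : ListAlternating D)
    (hX : ListHomogeneous m X) (hD : ListHomogeneous n D) :
    ListHomogeneous (m + n) (listBracket m n X D) := by
  intro l hl
  rw [_root_.listBracket, ListHomogeneous.listCirc hXa hX hD l hl,
    ListHomogeneous.listCirc hDa hD hX l (by omega), smul_zero, sub_zero]

theorem listBracket_add_left (m n : ℕ) (X Y : List V → Module.End ℝ V)
    {D : List V → Module.End ℝ V} (hD : ListAlternating D) (l : List V) :
    listBracket m n (fun l => X l + Y l) D l = listBracket m n X D l + listBracket m n Y D l := by
  simp only [listBracket, listCirc_add_left, listCirc_add_right hD, smul_add]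
  abel

theorem listBracket_add_right (m n : ℕ) {X : List V → Module.End ℝ V} (hX : ListAlternating X)
    (D E : List V → Module.End ℝ V) (l : List V) :
    listBracket m n X (fun l => D l + E l) l = listBracket m n X D l + listBracket m n X E l := by
  simp only [listBracket, listCirc_add_left, listCirc_add_right hX, smul_add]
  abel

theorem listBracket_smul_left (m n : ℕ) (c : ℝ) (X : List V → Module.End ℝ V)
    {D : List V → Module.End ℝ V} (hD : ListAlternating D) (l : List V) :
    listBracket m n (fun l => c • X l) D l = c • listBracket m n X D l := by
  simp only [listBracket, listCirc_smul_left, listCirc_smul_right hD, smul_sub,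
    smul_comm _ c (listCirc D X l)]

theorem listBracket_smul_right (m n : ℕ) (c : ℝ) {X : List V → Module.End ℝ V}
    (hX : ListAlternating X) (D : List V → Module.End ℝ V) (l : List V) :
    listBracket m n X (fun l => c • D l) l = c • listBracket m n X D l := by
  simp only [listBracket, listCirc_smul_left, listCirc_smul_right hX, smul_sub,
    smul_comm _ c (listCirc D X l)]

theorem listBracket_skew (m n : ℕ) (X D : List V → Module.End ℝ V) (l : List V) :
    listBracket m n X D l = -((-1 : ℤ) ^ (m * n) • listBracket n m D X l) := by
  have h : (-1 : ℤ) ^ (m * n) * (-1 : ℤ) ^ (m * n) = 1 := by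
    rw [← pow_add, ← two_mul, pow_mul]; simp
  rw [listBracket, listBracket, mul_comm n m, smul_sub, smul_smul, h, one_smul]
  abel

/-- Expanding the three double brackets gives twelve products, which group into the pre-Lie
identities with `X`, `D` and `E` as outer factor. -/
theorem listBracket_jacobi {m n k : ℕ} {X D E : List V → Module.End ℝ V}
    (hX : ListAlternating X) (hD : ListAlternating D) (hE : ListAlternating E)
    (hXm : ListHomogeneous m X) (hDn : ListHomogeneous n D) (hEk : ListHomogeneous k E)
    (l : List V) :
    listBracket m (n + k) X (listBracket n k D E) l =
      listBracket (m + n) k (listBracket m n X D) E l +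
        (-1 : ℤ) ^ (m * n) • listBracket n (m + k) D (listBracket m k X E) l := by
  have r : ∀ {p q : ℕ} {X D E : List V → Module.End ℝ V}, ListAlternating X →
      listCirc X (listBracket p q D E) l =
        listCirc X (listCirc D E) l - (-1 : ℤ) ^ (p * q) • listCirc X (listCirc E D) l := by
    intro p q X D E hX
    have : listBracket p q D E =
        fun l => listCirc D E l + (-(-1 : ℤ) ^ (p * q)) • listCirc E D l := by
      ext1 l; rw [listBracket, neg_smul, sub_eq_add_neg]
    rw [this, listCirc_add_right hX, listCirc_zsmul_right hX]
    simp only [neg_smul, sub_eq_add_neg]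
  have r' : ∀ {p q : ℕ} {X D E : List V → Module.End ℝ V},
      listCirc (listBracket p q D E) X l =
        listCirc (listCirc D E) X l - (-1 : ℤ) ^ (p * q) • listCirc (listCirc E D) X l := by
    intro p q X D E
    have : listBracket p q D E =
        fun l => listCirc D E l + (-(-1 : ℤ) ^ (p * q)) • listCirc E D l := by
      ext1 l; rw [listBracket, neg_smul, sub_eq_add_neg]
    rw [this, listCirc_add_left, listCirc_zsmul_left]
    simp only [neg_smul, sub_eq_add_neg]
  have p₁ := listCirc_preLie hX hDn hEk l
  have p₂ := listCirc_preLie hD hXm hEk l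
  have p₃ := listCirc_preLie hE hXm hDn l
  rw [listBracket, listBracket, listBracket, r hX, r hE, r hD, r', r', r', mul_add, add_mul,
    mul_add, mul_comm n m, pow_add, pow_add, pow_add]
  have ha := neg_one_pow_eq_or ℤ (m * n)
  have hb := neg_one_pow_eq_or ℤ (m * k)
  have hc := neg_one_pow_eq_or ℤ (n * k)
  generalize (-1 : ℤ) ^ (m * n) = a at *
  generalize (-1 : ℤ) ^ (m * k) = b at *
  generalize (-1 : ℤ) ^ (n * k) = c at *
  -- The weights are the signs with which the three associators enter: `-1`, `(-1)^{mn}` and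
  -- `-(-1)^{(m+n)k}`. The powers are then replaced by their values `±1`.
  linear_combination (norm := skip) (-1 : ℤ) • p₁ + a • p₂ - (b * c) • p₃
  rcases ha with rfl | rfl <;> rcases hb with rfl | rfl <;> rcases hc with rfl | rfl <;>
  · simp only [mul_one, one_smul, mul_neg, neg_smul, neg_neg]
    abel

end ListComposition

/-! ### Sums over unshuffles as signed shuffle sums -/

section Unshuffles

/-- The permutation that sends the position `i` to the first letter and acts as `τ` on the remaining
positions and letters. -/
def insertPerm {N : ℕ} (i : Fin (N + 1)) (τ : Equiv.Perm (Fin N)) : Equiv.Perm (Fin (N + 1)) :=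
  Equiv.Perm.decomposeFin.symm (0, τ) * i.cycleRange

theorem insertPerm_self {N : ℕ} (i : Fin (N + 1)) (τ : Equiv.Perm (Fin N)) :
    insertPerm i τ i = 0 := by
  simp [insertPerm]

theorem insertPerm_succAbove {N : ℕ} (i : Fin (N + 1)) (τ : Equiv.Perm (Fin N)) (j : Fin N) :
    insertPerm i τ (i.succAbove j) = (τ j).succ := by
  simp [insertPerm, Fin.cycleRange_succAbove]

theorem sign_insertPerm {N : ℕ} (i : Fin (N + 1)) (τ : Equiv.Perm (Fin N)) :
    Equiv.Perm.sign (insertPerm i τ) = (-1) ^ (i : ℕ) * Equiv.Perm.sign τ := by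
  simp [insertPerm, Fin.sign_cycleRange, mul_comm]

theorem insertPerm_bijective (N : ℕ) :
    Function.Bijective (fun x : Fin (N + 1) × Equiv.Perm (Fin N) => insertPerm x.1 x.2) := by
  rw [Fintype.bijective_iff_injective_and_card]
  refine ⟨?_, by simp [Fintype.card_perm, Nat.factorial_succ]⟩
  rintro ⟨i, τ⟩ ⟨j, ρ⟩ h
  simp only at h
  have hij : i = j := by
    apply (insertPerm j ρ).injective
    rw [insertPerm_self, ← h, insertPerm_self]
  subst hij
  have : τ = ρ := by
    ext1 k
    have := congrArg (fun σ => σ (i.succAbove k)) h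
    simpa [insertPerm_succAbove] using this
  rw [this]

/-- Position `i` carries the smallest letter, so within the block it can only come first; deleting
it shifts the later block bounds by one. -/
theorem increasingOnBlock_insertPerm {N : ℕ} (i : Fin (N + 1)) (τ : Equiv.Perm (Fin N)) (a b : ℕ) :
    IncreasingOnBlock (insertPerm i τ) a b ↔ (a < (i : ℕ) → (i : ℕ) < b → False) ∧
      IncreasingOnBlock τ (if (i : ℕ) < a then a - 1 else a) (if (i : ℕ) < b then b - 1 else b) := by
  have hs : ∀ j : Fin N, ((i.succAbove j : Fin (N + 1)) : ℕ) = if (j : ℕ) < i then (j : ℕ) else j + 1 := by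
    intro j
    simp only [Fin.succAbove, Fin.lt_def, Fin.val_castSucc]
    split_ifs <;> simp
  constructor
  · refine fun h => ⟨fun h₁ h₂ => ?_, fun j k hj hjk hk => ?_⟩
    · have := h ⟨a, by omega⟩ i le_rfl (by simpa [Fin.lt_def] using h₁) h₂
      rw [insertPerm_self] at this
      exact absurd this (Fin.not_lt_zero _)
    · have hjk' : i.succAbove j < i.succAbove k := Fin.succAbove_lt_succAbove_iff.2 hjk
      have := h (i.succAbove j) (i.succAbove k) ?_ hjk' ?_
      · simpa [insertPerm_succAbove] using this
      · rw [hs]; split_ifs at * <;> omega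
      · rw [hs]; split_ifs at * <;> omega
  · rintro ⟨h₁, h₂⟩ j k hj hjk hk
    rcases Fin.eq_self_or_eq_succAbove i j with rfl | ⟨j', rfl⟩
    · obtain ⟨k', rfl⟩ := Fin.exists_succAbove_eq (ne_of_gt hjk)
      rw [insertPerm_self, insertPerm_succAbove]
      exact Fin.succ_pos _
    rcases Fin.eq_self_or_eq_succAbove i k with rfl | ⟨k', rfl⟩
    · exact (h₁ (lt_of_le_of_lt hj hjk) hk).elim
    rw [insertPerm_succAbove, insertPerm_succAbove, Fin.succ_lt_succ_iff]
    have hjk' := Fin.succAbove_lt_succAbove_iff.1 hjk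
    rw [hs] at hj hk
    refine h₂ j' k' ?_ hjk' ?_
    · split_ifs at * <;> omega
    · split_ifs at * <;> omega

theorem mem_unshuffles {N p q : ℕ} {σ : Equiv.Perm (Fin N)} : σ ∈ unshuffles N p q ↔
    IncreasingOnBlock σ 0 p ∧ IncreasingOnBlock σ p (p + q) ∧ IncreasingOnBlock σ (p + q) N := by
  simp [unshuffles]

/-- The smallest letter opens one of the three blocks, which must be nonempty; for the last block
this follows from `i ≤ N`. -/
theorem insertPerm_mem_unshuffles {N p q : ℕ} (i : Fin (N + 1))
    (τ : Equiv.Perm (Fin N)) : insertPerm i τ ∈ unshuffles (N + 1) p q ↔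
      ((i : ℕ) = 0 ∧ 0 < p ∧ τ ∈ unshuffles N (p - 1) q) ∨
      ((i : ℕ) = p ∧ 0 < q ∧ τ ∈ unshuffles N p (q - 1)) ∨
      ((i : ℕ) = p + q ∧ τ ∈ unshuffles N p q) := by
  have hi := i.2
  simp only [mem_unshuffles, increasingOnBlock_insertPerm]
  rcases lt_or_ge (i : ℕ) p with h₁ | h₁
  · have e₁ : (i : ℕ) < p + q := by omega
    have e₂ : p - 1 + q = p + q - 1 := by omega
    have e₃ : ¬ (p < (i : ℕ)) := by omega
    have e₄ : ¬ (p + q < (i : ℕ)) := by omega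
    have e₅ : (i : ℕ) ≠ p := by omega
    have e₆ : (i : ℕ) ≠ p + q := by omega
    simp only [h₁, e₁, e₂, e₃, e₄, e₅, e₆, hi, if_true, forall_true_left, false_and, or_false,
      false_implies, true_and, Nat.not_lt_zero, if_false, Nat.add_sub_cancel]
    constructor
    · rintro ⟨⟨h, h'⟩, h'', h'''⟩
      exact ⟨Nat.eq_zero_of_not_pos h, by omega, h', h'', h'''⟩
    · rintro ⟨h, -, h', h'', h'''⟩
      exact ⟨⟨by omega, h'⟩, h'', h'''⟩
  rcases lt_or_ge (i : ℕ) (p + q) with h₂ | h₂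
  · have e₁ : ¬ (i : ℕ) < p := by omega
    have e₂ : p + (q - 1) = p + q - 1 := by omega
    have e₄ : ¬ (p + q < (i : ℕ)) := by omega
    have e₅ : ¬ ((i : ℕ) = 0 ∧ 0 < p) := by omega
    have e₆ : (i : ℕ) ≠ p + q := by omega
    have e₇ : 0 < q := by omega
    simp only [h₂, e₁, e₂, e₄, e₆, e₇, hi, if_true, false_and, or_false, ← and_assoc, e₅, false_or,
      false_implies, true_and, Nat.not_lt_zero, if_false, Nat.add_sub_cancel, implies_true,
      forall_true_left]
    constructor
    · rintro ⟨⟨⟨h, h'⟩, h''⟩, h'''⟩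
      exact ⟨⟨⟨le_antisymm (not_lt.1 h') h₁, h⟩, h''⟩, h'''⟩
    · rintro ⟨⟨⟨h, h'⟩, h''⟩, h'''⟩
      exact ⟨⟨⟨h', by omega⟩, h''⟩, h'''⟩
  · have e₁ : ¬ (i : ℕ) < p := by omega
    have e₄ : ¬ ((i : ℕ) < p + q) := by omega
    have e₅ : ¬ ((i : ℕ) = 0 ∧ 0 < p) := by omega
    have e₆ : ¬ ((i : ℕ) = p ∧ 0 < q) := by omega
    simp only [e₁, e₄, hi, if_true, false_and, ← and_assoc, e₅, e₆, false_or,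
      false_implies, true_and, Nat.not_lt_zero, if_false, Nat.add_sub_cancel, implies_true,
      forall_true_left]
    constructor
    · rintro ⟨⟨⟨h, h'⟩, h''⟩, h'''⟩
      exact ⟨⟨⟨le_antisymm (not_lt.1 h'') h₂, h⟩, h'⟩, h'''⟩
    · rintro ⟨⟨⟨h, h'⟩, h''⟩, h'''⟩
      exact ⟨⟨⟨h', h''⟩, by omega⟩, h'''⟩

variable {α W : Type*} [AddCommGroup W]

/-- Matches the recursion of a nested `shuffleSum`, by the block containing the smallest letter.
`Fin.ofNat` reduces modulo `N + 1`, but each guard ensures that no reduction takes place. -/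
theorem sum_unshuffles_succ {N p q : ℕ} (hpq : p + q ≤ N + 1)
    (f : Equiv.Perm (Fin (N + 1)) → W) :
    ∑ σ ∈ unshuffles (N + 1) p q, f σ =
      (if 0 < p then ∑ τ ∈ unshuffles N (p - 1) q, f (insertPerm 0 τ) else 0) +
      (if 0 < q then ∑ τ ∈ unshuffles N p (q - 1), f (insertPerm (Fin.ofNat (N + 1) p) τ) else 0) +
      (if p + q ≤ N then ∑ τ ∈ unshuffles N p q, f (insertPerm (Fin.ofNat (N + 1) (p + q)) τ)
        else 0) := by
  classical
  have h₁ : ∑ σ ∈ unshuffles (N + 1) p q, f σ = ∑ i : Fin (N + 1), ∑ τ : Equiv.Perm (Fin N),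
      if insertPerm i τ ∈ unshuffles (N + 1) p q then f (insertPerm i τ) else 0 := by
    rw [← Fintype.sum_prod_type',
      (insertPerm_bijective N).sum_comp (fun σ => if σ ∈ unshuffles (N + 1) p q then f σ else 0)]
    simp
  have h₂ : ∀ i : Fin (N + 1), (∑ τ : Equiv.Perm (Fin N),
      if insertPerm i τ ∈ unshuffles (N + 1) p q then f (insertPerm i τ) else 0) =
      (if i = 0 then if 0 < p then ∑ τ ∈ unshuffles N (p - 1) q, f (insertPerm i τ) else 0
        else 0) +
      (if i = Fin.ofNat (N + 1) p then
        if 0 < q then ∑ τ ∈ unshuffles N p (q - 1), f (insertPerm i τ) else 0 else 0) +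
      (if i = Fin.ofNat (N + 1) (p + q) then
        if p + q ≤ N then ∑ τ ∈ unshuffles N p q, f (insertPerm i τ) else 0 else 0) := by
    intro i
    have hi := i.2
    have e₀ : i = 0 ↔ (i : ℕ) = 0 := Fin.ext_iff
    have e₁ : 0 < q → (i = Fin.ofNat (N + 1) p ↔ (i : ℕ) = p) := fun hq => by
      rw [Fin.ext_iff, Fin.val_ofNat, Nat.mod_eq_of_lt (by omega)]
    have e₂ : p + q ≤ N → (i = Fin.ofNat (N + 1) (p + q) ↔ (i : ℕ) = p + q) := fun hq => by
      rw [Fin.ext_iff, Fin.val_ofNat, Nat.mod_eq_of_lt (by omega)]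
    simp only [insertPerm_mem_unshuffles]
    by_cases c₁ : (i : ℕ) = 0 ∧ 0 < p
    · have : ¬ ((i : ℕ) = p ∧ 0 < q) := by omega
      have c₂ : ¬ (i = Fin.ofNat (N + 1) p ∧ 0 < q) := fun h => this ⟨(e₁ h.2).1 h.1, h.2⟩
      have : ¬ ((i : ℕ) = p + q ∧ p + q ≤ N) := by omega
      have c₃ : ¬ (i = Fin.ofNat (N + 1) (p + q) ∧ p + q ≤ N) := fun h => this ⟨(e₂ h.2).1 h.1, h.2⟩
      simp only [← ite_and, c₂, c₃, e₀, c₁]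
      have d₂ : ¬ (0 = p ∧ 0 < q) := fun h => by omega
      have d₃ : ¬ (0 = p + q) := fun h => by omega
      simp [← and_assoc, d₂, d₃]
    by_cases c₂ : (i : ℕ) = p ∧ 0 < q
    · have : ¬ ((i : ℕ) = p + q ∧ p + q ≤ N) := by omega
      have c₃ : ¬ (i = Fin.ofNat (N + 1) (p + q) ∧ p + q ≤ N) := fun h => this ⟨(e₂ h.2).1 h.1, h.2⟩
      have d₃ : ¬ ((i : ℕ) = p + q) := fun h => by omega
      simp only [← ite_and, c₃, e₀, ← and_assoc, c₁, e₁ c₂.2, d₃]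
      simp [c₂]
    · have c₂' : ¬ (i = Fin.ofNat (N + 1) p ∧ 0 < q) := fun h => c₂ ⟨(e₁ h.2).1 h.1, h.2⟩
      simp only [← ite_and, e₀, ← and_assoc, c₁, c₂, c₂', false_and, false_or, if_false, zero_add]
      by_cases c₃ : (i : ℕ) = p + q
      · have : p + q ≤ N := by omega
        rw [if_pos ⟨(e₂ this).2 c₃, this⟩]
        simp [c₃]
      · have : ¬ (i = Fin.ofNat (N + 1) (p + q) ∧ p + q ≤ N) := fun h => c₃ ((e₂ h.2).1 h.1)
        rw [if_neg this]
        simp [c₃]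
  rw [h₁, Finset.sum_congr rfl fun i _ => h₂ i]
  simp [Finset.sum_add_distrib]

theorem ofFn_comp_insertPerm {N : ℕ} (u : Fin (N + 1) → α) (i : Fin (N + 1))
    (τ : Equiv.Perm (Fin N)) : List.ofFn (u ∘ insertPerm i τ) =
      (List.ofFn (Fin.tail u ∘ τ)).take i ++ u 0 :: (List.ofFn (Fin.tail u ∘ τ)).drop i := by
  have hi := i.2
  have hm : min (i : ℕ) N = i := min_eq_left (by omega)
  refine List.ext_getElem (by simp; omega) fun k hk _ => ?_
  simp only [List.length_ofFn] at hk
  simp only [List.getElem_ofFn, Function.comp_apply]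
  rcases Fin.eq_self_or_eq_succAbove i ⟨k, hk⟩ with h | ⟨j, h⟩
  · have hk' : k = i := congrArg Fin.val h
    rw [h, insertPerm_self, List.getElem_append_right (by simp; omega)]
    simp [hk', hm]
  · have hs : k = if (j : ℕ) < i then (j : ℕ) else j + 1 := by
      have := congrArg Fin.val h
      simp only at this
      rw [this]
      simp only [Fin.succAbove, Fin.lt_def, Fin.val_castSucc]
      split_ifs <;> simp
    rw [h, insertPerm_succAbove]
    rcases lt_or_ge (j : ℕ) i with hj | hj
    · rw [if_pos hj] at hs
      rw [List.getElem_append_left (by simp; omega)]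
      simp [hs, Fin.tail]
    · rw [if_neg (by omega)] at hs
      subst hs
      rw [List.getElem_append_right (by simp; omega)]
      have : (j : ℕ) + 1 - i = (j - i) + 1 := by omega
      simp [hm, this, Fin.tail, Nat.add_sub_cancel' hj]

/-- Induction on `N`: sending the first letter to the start of the second or third block costs
`(-1)^p` or `(-1)^{p+q}`, the same sign as passing it over the sublists `a`, or `a` and `b`. -/
theorem sum_unshuffles {N p q : ℕ} (hpq : p + q ≤ N) (u : Fin N → α)
    (G : List α → List α → List α → W) :
    ∑ σ ∈ unshuffles N p q, (Equiv.Perm.sign σ : ℤ) • G ((List.ofFn (u ∘ σ)).take p)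
        (((List.ofFn (u ∘ σ)).take (p + q)).drop p) ((List.ofFn (u ∘ σ)).drop (p + q)) =
      shuffleSum (List.ofFn u) (fun a r => shuffleSum r (fun b c =>
        if a.length = p ∧ b.length = q then G a b c else 0)) := by
  induction N generalizing p q G with
  | zero =>
    obtain rfl : p = 0 := by omega
    obtain rfl : q = 0 := by omega
    have : unshuffles 0 0 0 = {1} := by
      ext σ
      simp [mem_unshuffles, IncreasingOnBlock, Subsingleton.elim σ 1]
    simp [this, shuffleSum]
  | succ N ih =>
    rw [sum_unshuffles_succ hpq, List.ofFn_succ, shuffleSum]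
    simp only [shuffleSum, smul_add, shuffleSum_add, ← add_assoc]
    congr 1
    congr 1
    · split_ifs with hp
      · obtain ⟨p, rfl⟩ := Nat.exists_eq_succ_of_ne_zero hp.ne'
        have := ih (p := p) (q := q) (by omega) (Fin.tail u) (fun a b c => G (u 0 :: a) b c)
        simp only [Nat.succ_eq_add_one, Nat.add_sub_cancel, List.length_cons, Nat.add_right_cancel_iff]
        refine Eq.trans ?_ this
        refine Finset.sum_congr rfl fun τ _ => ?_
        rw [sign_insertPerm, ofFn_comp_insertPerm]
        simp [show p + 1 + q = p + q + 1 by omega]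
      · obtain rfl : p = 0 := by omega
        simp [shuffleSum_zero]
    · split_ifs with hq
      · obtain ⟨q, rfl⟩ := Nat.exists_eq_succ_of_ne_zero hq.ne'
        have := ih (p := p) (q := q) (by omega) (Fin.tail u)
          (fun a b c => (-1 : ℤ) ^ p • G a (u 0 :: b) c)
        simp only [Nat.succ_eq_add_one, Nat.add_sub_cancel, List.length_cons, Nat.add_right_cancel_iff]
        refine Eq.trans ?_ (this.trans ?_)
        · refine Finset.sum_congr rfl fun τ _ => ?_
          have hv : ((Fin.ofNat (N + 1) p : Fin (N + 1)) : ℕ) = p := by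
            rw [Fin.val_ofNat, Nat.mod_eq_of_lt (by omega)]
          have hl : ((List.ofFn (Fin.tail u ∘ τ)).take p).length = p := by simp; omega
          rw [sign_insertPerm, ofFn_comp_insertPerm, hv, smul_smul, Units.val_mul]
          generalize List.ofFn (Fin.tail u ∘ τ) = L at *
          congr 1
          · push_cast; ring
          · congr 1
            · exact List.take_left' hl
            · rw [List.drop_take, List.drop_left' hl, List.drop_take]
              simp [show p + (q + 1) - p = q + 1 by omega]
            · rw [List.drop_append, hl]
              simp [show p + (q + 1) - p = q + 1 by omega]
        · refine shuffleSum_congr _ fun a r _ => ?_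
          rw [← shuffleSum_zsmul]
          refine shuffleSum_congr _ fun b c _ => ?_
          by_cases h : a.length = p ∧ b.length = q
          · simp [h]
          · simp only [h, if_false, smul_zero]
      · obtain rfl : q = 0 := by omega
        simp [shuffleSum_zero]
    · split_ifs with hq
      · have := ih (p := p) (q := q) (by omega) (Fin.tail u)
          (fun a b c => (-1 : ℤ) ^ (p + q) • G a b (u 0 :: c))
        refine Eq.trans ?_ (this.trans ?_)
        · refine Finset.sum_congr rfl fun τ _ => ?_
          have hv : ((Fin.ofNat (N + 1) (p + q) : Fin (N + 1)) : ℕ) = p + q := by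
            rw [Fin.val_ofNat, Nat.mod_eq_of_lt (by omega)]
          have hl : ((List.ofFn (Fin.tail u ∘ τ)).take (p + q)).length = p + q := by simp; omega
          rw [sign_insertPerm, ofFn_comp_insertPerm, hv, smul_smul, Units.val_mul]
          generalize List.ofFn (Fin.tail u ∘ τ) = L at *
          congr 1
          · push_cast; ring
          · congr 1
            · rw [List.take_append_of_le_length (by omega), List.take_take]
              simp
            · rw [List.take_left' hl]
            · exact List.drop_left' hl
        · refine shuffleSum_congr _ fun a r _ => ?_
          rw [← shuffleSum_zsmul]
          refine shuffleSum_congr _ fun b c _ => ?_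
          by_cases h : a.length = p ∧ b.length = q
          · simp [h, smul_smul, pow_add]
          · simp only [h, if_false, smul_zero]
      -- Here `p + q = N + 1`: the third block is empty, and the other `N` letters are too few to
      -- fill the first two.
      · symm
        rw [shuffleSum_congr _ (G' := fun _ _ => 0), shuffleSum_zero]
        intro a r h
        rw [shuffleSum_congr _ (G' := fun _ _ => 0), shuffleSum_zero, smul_zero]
        intro b c h'
        rw [if_neg, smul_zero]
        simp only [List.length_ofFn] at h
        omega

end Unshuffles

/-! ### Cochains as functions of lists -/

section CochainLists

variable {V : Type*} [AddCommGroup V] [Module ℝ V]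

/-- A cochain of degree `n` as a function of lists, zero on lists of length other than `n`. -/
def MNCochain.onList {n : ℕ} (D : MNCochain V n) (l : List V) : Module.End ℝ V :=
  if h : l.length = n then D (fun i => l.get (i.cast h.symm)) else 0

theorem MNCochain.onList_ofFn {n : ℕ} (D : MNCochain V n) (u : Fin n → V) :
    D.onList (List.ofFn u) = D u := by
  rw [onList, dif_pos (List.length_ofFn)]
  congr 1
  ext i
  simp

theorem MNCochain.onList_homogeneous {n : ℕ} (D : MNCochain V n) : ListHomogeneous n D.onList :=
  fun _ hl => dif_neg hl

theorem List.get_append_cons_eq_update {α : Type*} {n : ℕ} (p : List α) (x y : α) (l : List α)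
    (hx : n = (p ++ x :: l).length) (hy : n = (p ++ y :: l).length) (hp : p.length < n) :
    (fun i : Fin n => (p ++ y :: l).get (i.cast hy)) =
      Function.update (fun i : Fin n => (p ++ x :: l).get (i.cast hx)) ⟨p.length, hp⟩ y := by
  ext i
  rcases lt_trichotomy (i : ℕ) p.length with h | h | h
  · rw [Function.update_of_ne (by rintro rfl; simp at h)]
    simp [List.getElem_append_left h]
  · obtain rfl : i = ⟨p.length, hp⟩ := Fin.ext h
    simp
  · rw [Function.update_of_ne (by rintro rfl; simp at h)]
    obtain ⟨k, hk⟩ := Nat.exists_eq_add_of_lt h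
    simp [List.getElem_append_right h.le, show (i : ℕ) - p.length = k + 1 by omega]

theorem List.get_append_swap {α : Type*} {n : ℕ} (p : List α) (x y : α) (l : List α)
    (hx : n = (p ++ x :: y :: l).length) (hy : n = (p ++ y :: x :: l).length)
    (hp : p.length + 1 < n) :
    (fun i : Fin n => (p ++ x :: y :: l).get (i.cast hx)) =
      (fun i : Fin n => (p ++ y :: x :: l).get (i.cast hy)) ∘
        Equiv.swap (⟨p.length, by omega⟩ : Fin n) ⟨p.length + 1, hp⟩ := by
  ext i
  simp only [Function.comp_apply]
  rcases eq_or_ne i ⟨p.length, by omega⟩ with rfl | h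
  · simp
  rcases eq_or_ne i ⟨p.length + 1, hp⟩ with rfl | h'
  · simp
  rw [Equiv.swap_apply_of_ne_of_ne h h']
  rw [Ne, Fin.ext_iff] at h h'
  simp only at h h'
  rcases lt_or_ge (i : ℕ) p.length with h₁ | h₁
  · simp [List.getElem_append_left h₁]
  · obtain ⟨k, hk⟩ : ∃ k, (i : ℕ) - p.length = k + 1 + 1 := ⟨i - p.length - 2, by omega⟩
    simp [List.getElem_append_right h₁, hk]

theorem MNCochain.onList_alternating {n : ℕ} (D : MNCochain V n) : ListAlternating D.onList := by
  refine ⟨fun p x y l => ?_, fun p c x l => ?_, fun p x y l => ?_⟩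
  · by_cases h : n = (p ++ x :: l).length
    · have hp : p.length < n := by rw [h]; simp
      have h₁ : n = (p ++ (x + y) :: l).length := by rw [h]; simp
      have h₂ : n = (p ++ y :: l).length := by rw [h]; simp
      -- The list with `0` in the distinguished place is a common base point, of which all three
      -- arguments are updates.
      rw [onList, onList, onList, dif_pos h₁.symm, dif_pos h.symm, dif_pos h₂.symm,
        List.get_append_cons_eq_update p 0 (x + y) l (by simpa using h) h₁ hp,
        List.get_append_cons_eq_update p 0 x l (by simpa using h) h hp,
        List.get_append_cons_eq_update p 0 y l (by simpa using h) h₂ hp, D.map_update_add]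
    · rw [onList, onList, onList, dif_neg, dif_neg, dif_neg, add_zero] <;>
      · intro h'
        apply h
        rw [← h']
        try simp
  · by_cases h : n = (p ++ x :: l).length
    · have hp : p.length < n := by rw [h]; simp
      have h₁ : n = (p ++ (c • x) :: l).length := by rw [h]; simp
      rw [onList, onList, dif_pos h₁.symm, dif_pos h.symm,
        List.get_append_cons_eq_update p 0 (c • x) l (by simpa using h) h₁ hp,
        List.get_append_cons_eq_update p 0 x l (by simpa using h) h hp, D.map_update_smul]
    · rw [onList, onList, dif_neg, dif_neg, smul_zero] <;>
      · intro h'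
        apply h
        rw [← h']
        try simp
  · by_cases h : n = (p ++ x :: y :: l).length
    · have hp : p.length + 1 < n := by rw [h]; simp
      have h₁ : n = (p ++ y :: x :: l).length := by rw [h]; simp
      rw [onList, onList, dif_pos h₁.symm, dif_pos h.symm, List.get_append_swap p x y l h h₁ hp,
        D.map_swap _ (by simp)]
    · rw [onList, onList, dif_neg, dif_neg, neg_zero] <;>
      · intro h'
        apply h
        rw [← h']
        try simp

theorem List.ofFn_update {α : Type*} {n : ℕ} (u : Fin n → α) (i : Fin n) (x : α) :
    List.ofFn (Function.update u i x) =
      (List.ofFn u).take i ++ x :: (List.ofFn u).drop (i + 1) := by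
  have : List.ofFn (Function.update u i x) = (List.ofFn u).set i x := by
    refine List.ext_getElem (by simp) fun k hk _ => ?_
    simp only [List.getElem_ofFn, List.getElem_set, Function.update_apply, Fin.ext_iff, eq_comm]
  rw [this, List.set_eq_take_append_cons_drop, if_pos (by simp)]

/-- The cochain of degree `n` given by an alternating function of lists. -/
def ListAlternating.toCochain {Y : List V → Module.End ℝ V} (hY : ListAlternating Y) (n : ℕ) :
    MNCochain V n where
  toFun u := Y (List.ofFn u)
  map_update_add' u i x y := by
    rename_i inst
    rw [Subsingleton.elim inst (instDecidableEqFin n)]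
    simp only [List.ofFn_update, hY.add]
  map_update_smul' u i c x := by
    rename_i inst
    rw [Subsingleton.elim inst (instDecidableEqFin n)]
    simp only [List.ofFn_update, hY.smul]
  map_eq_zero_of_eq' u i j h hij := by
    refine hY.eq_zero_of_not_nodup fun hn => hij ?_
    exact (List.nodup_ofFn.1 hn) h

theorem ListAlternating.toCochain_apply {Y : List V → Module.End ℝ V} (hY : ListAlternating Y)
    {n : ℕ} (u : Fin n → V) : hY.toCochain n u = Y (List.ofFn u) := rfl

theorem ListAlternating.onList_toCochain {Y : List V → Module.End ℝ V} (hY : ListAlternating Y)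
    {n : ℕ} (hn : ListHomogeneous n Y) : (hY.toCochain n).onList = Y := by
  ext1 l
  by_cases h : l.length = n
  · subst h
    have := (hY.toCochain l.length).onList_ofFn l.get
    rw [hY.toCochain_apply, List.ofFn_get] at this
    exact this
  · rw [MNCochain.onList_homogeneous _ _ h, hn l h]

theorem MNCochain.onList_injective {n : ℕ} {D D' : MNCochain V n} (h : D.onList = D'.onList) :
    D = D' := by
  ext1 u
  rw [← D.onList_ofFn, ← D'.onList_ofFn, h]

theorem MNCochain.onList_add {n : ℕ} (D D' : MNCochain V n) :
    (D + D').onList = fun l => D.onList l + D'.onList l := by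
  ext1 l
  by_cases h : l.length = n
  · simp only [onList, dif_pos h]; rfl
  · simp [onList, dif_neg h]

theorem MNCochain.onList_smul {n : ℕ} (c : ℝ) (D : MNCochain V n) :
    (c • D).onList = fun l => c • D.onList l := by
  ext1 l
  by_cases h : l.length = n
  · simp only [onList, dif_pos h]; rfl
  · simp [onList, dif_neg h]

/-- The block of length one is the letter fed to the last slot of `D₂`. By antisymmetry of `D₁`,
extracting it with its sign and putting `D₂.onList a w` in front is the same as substituting in
place (`shuffleSum_extract`). -/
theorem MNCochain.sum_unshuffles_three {m n : ℕ} (hm : 0 < m) (D₁ : MNCochain V m)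
    (D₂ : MNCochain V n) (u : Fin (m + n) → V) (v : V) :
    ∑ σ ∈ unshuffles (m + n) n 1, Equiv.Perm.sign σ •
        D₁ (fun i : Fin m => if (i : ℕ) = 0 then
              D₂ (fun j : Fin n => u (σ ⟨j, by omega⟩)) (u (σ ⟨n, by omega⟩))
            else u (σ ⟨n + i, by omega⟩)) v =
      shuffleSum (List.ofFn u) (fun a r => substSum (D₂.onList a) r D₁.onList v) := by
  have key := sum_unshuffles (N := m + n) (p := n) (q := 1) (by omega) u
    (fun a b c => match b with
      | [w] => D₁.onList (D₂.onList a w :: c) v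
      | _ => 0)
  refine Eq.trans (Finset.sum_congr rfl fun σ _ => ?_) (key.trans ?_)
  · rw [Units.smul_def]
    congr 1
    have hb : ((List.ofFn (u ∘ σ)).take (n + 1)).drop n = [u (σ ⟨n, by omega⟩)] := by
      refine List.ext_getElem (by simp; omega) fun k hk hk' => ?_
      simp only [List.length_singleton, Nat.lt_one_iff] at hk'
      subst hk'
      simp
    have ha : (List.ofFn (u ∘ σ)).take n = List.ofFn (fun j : Fin n => u (σ ⟨j, by omega⟩)) :=
      List.ext_getElem (by simp) fun k hk hk' => by simp
    rw [hb, ha]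
    simp only
    rw [D₂.onList_ofFn, ← D₁.onList_ofFn]
    congr 2
    refine List.ext_getElem (by simp; omega) fun k hk hk' => ?_
    rcases k with _ | k
    · simp
    · simp [add_assoc, add_comm 1 k]
  · refine shuffleSum_congr _ fun a r _ => ?_
    have hs : substSum (D₂.onList a) r D₁.onList v =
        substSum (D₂.onList a) r (fun l => D₁.onList l v) :=
      map_substSum (LinearMap.applyₗ v : Module.End ℝ V →ₗ[ℝ] V).toAddMonoidHom _ _ _
    have hx := (D₁.onList_alternating.map (LinearMap.applyₗ v)).shuffleSum_extract (D₂.onList a) r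
    simp only [LinearMap.applyₗ_apply_apply] at hx
    rw [hs, ← hx]
    refine shuffleSum_congr _ fun b c _ => ?_
    by_cases ha : a.length = n
    · match b with
      | [] => simp
      | [w] => simp [ha]
      | _ :: _ :: _ => simp
    · rw [if_neg (fun h => ha h.1)]
      match b with
      | [] => simp
      | [w] =>
        simp only [D₂.onList_homogeneous a ha, LinearMap.zero_apply]
        -- `D₁` vanishes on a list with a zero entry, by homogeneity with scalar `0`.
        have := D₁.onList_alternating.smul_cons 0 0 c
        rw [zero_smul, zero_smul] at this
        rw [this, LinearMap.zero_apply]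
      | _ :: _ :: _ => simp

/-- Putting the arguments of `D₂` before those of `D₁` costs `(-1)^{mn}`, which cancels the
prefactor. -/
theorem MNCochain.sum_unshuffles_two {m n : ℕ} (D₁ : MNCochain V m)
    (D₂ : MNCochain V n) (u : Fin (m + n) → V) (v : V) :
    (-1 : ℤ) ^ (m * n) • ∑ σ ∈ unshuffles (m + n) m n, Equiv.Perm.sign σ •
        D₁ (fun i : Fin m => u (σ ⟨i, by omega⟩))
          (D₂ (fun j : Fin n => u (σ ⟨m + j, by omega⟩)) v) =
      shuffleSum (List.ofFn u) (fun a b => (D₁.onList b * D₂.onList a) v) := by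
  have key := sum_unshuffles (N := m + n) (p := m) (q := n) le_rfl u
    (fun a b _ => (D₁.onList a * D₂.onList b) v)
  have h : ∀ a r : List V, a.length + r.length = (List.ofFn u).length →
      shuffleSum r (fun b c => if a.length = m ∧ b.length = n then
        (D₁.onList a * D₂.onList b) v else 0) = (D₁.onList a * D₂.onList r) v := by
    intro a r har
    simp only [List.length_ofFn] at har
    -- Since `m + n` exhausts the list, for `|a| = m` the length condition on `b` says that `c` is
    -- empty; for other `a` both sides vanish.
    rw [shuffleSum_congr r (G' := fun b c => if c.length = 0 then
      (D₁.onList a * D₂.onList b) v else 0), shuffleSum_of_right_nil r (by simp)]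
    · simp
    · intro b c hbc
      by_cases ha : a.length = m
      · congr 1
        simp only [eq_iff_iff]
        omega
      · simp [D₁.onList_homogeneous a ha]
  rw [shuffleSum_congr _ h, shuffleSum_comm] at key
  have h₂ : shuffleSum (List.ofFn u) (fun a b => (D₁.onList b * D₂.onList a) v) = (-1 : ℤ) ^ (m * n) •
      shuffleSum (List.ofFn u)
        (fun a b => (-1 : ℤ) ^ (a.length * b.length) • (D₁.onList b * D₂.onList a) v) := by
    rw [← shuffleSum_zsmul]
    refine shuffleSum_congr _ fun a b _ => ?_
    by_cases hb : b.length = m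
    · by_cases ha : a.length = n
      · rw [ha, hb, smul_smul, mul_comm n m, ← pow_add, ← two_mul, pow_mul]
        simp
      · simp [D₂.onList_homogeneous a ha]
    · simp [D₁.onList_homogeneous b hb]
  rw [h₂, ← key]
  congr 1
  refine Finset.sum_congr rfl fun σ _ => ?_
  rw [Units.smul_def]
  congr 1
  have ha : (List.ofFn (u ∘ σ)).take m = List.ofFn (fun j : Fin m => u (σ ⟨j, by omega⟩)) :=
    List.ext_getElem (by simp) fun k hk hk' => by simp
  have hb : ((List.ofFn (u ∘ σ)).take (m + n)).drop m =
      List.ofFn (fun j : Fin n => u (σ ⟨m + j, by omega⟩)) :=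
    List.ext_getElem (by simp) fun k hk hk' => by simp
  rw [ha, hb, D₁.onList_ofFn, D₂.onList_ofFn, Module.End.mul_apply]

/-- On lists, the Matsushima–Nijenhuis composition is `listCirc`. -/
theorem mnCirc_eq_listCirc {m n : ℕ} (D₁ : MNCochain V m) (D₂ : MNCochain V n)
    (u : Fin (m + n) → V) (v : V) :
    mnCirc D₁ D₂ u v = listCirc D₁.onList D₂.onList (List.ofFn u) v := by
  have hl : listCirc D₁.onList D₂.onList (List.ofFn u) v =
      shuffleSum (List.ofFn u) (fun a b => substSum (D₂.onList a) b D₁.onList v) +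
      shuffleSum (List.ofFn u) (fun a b => (D₁.onList b * D₂.onList a) v) := by
    rw [← shuffleSum_add]
    exact map_shuffleSum (LinearMap.applyₗ v : Module.End ℝ V →ₗ[ℝ] V).toAddMonoidHom _ _
  rw [hl, mnCirc, MNCochain.sum_unshuffles_two]
  congr 1
  split_ifs with hm
  · exact MNCochain.sum_unshuffles_three hm D₁ D₂ u v
  -- A cochain of degree zero has no list entry to substitute into, so the first sum is zero here as
  -- well.
  · obtain rfl : m = 0 := by omega
    rw [shuffleSum_congr _ (G' := fun _ _ => 0), shuffleSum_zero]
    intro a b _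
    rcases b with _ | ⟨x, b⟩
    · rfl
    · rw [substSum_congr (g := fun _ => (0 : ℤ) • (0 : Module.End ℝ V)), substSum_zsmul, zero_smul,
        LinearMap.zero_apply]
      intro c hc
      rw [smul_zero, D₁.onList_homogeneous c (by simp [hc])]

/-- The Matsushima–Nijenhuis bracket as a cochain. -/
def mnBracketCochain {m n : ℕ} (D₁ : MNCochain V m) (D₂ : MNCochain V n) : MNCochain V (m + n) :=
  (ListAlternating.listBracket (m := m) (n := n) D₁.onList_alternating
    D₂.onList_alternating).toCochain (m + n)

theorem onList_mnBracketCochain {m n : ℕ} (D₁ : MNCochain V m) (D₂ : MNCochain V n) :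
    (mnBracketCochain D₁ D₂).onList = listBracket m n D₁.onList D₂.onList :=
  ListAlternating.onList_toCochain _ (ListHomogeneous.listBracket D₁.onList_alternating
    D₂.onList_alternating D₁.onList_homogeneous D₂.onList_homogeneous)

theorem mnBracketCochain_apply {m n : ℕ} (D₁ : MNCochain V m) (D₂ : MNCochain V n)
    (u : Fin (m + n) → V) (v : V) : mnBracketCochain D₁ D₂ u v = mnBracket D₁ D₂ u v := by
  have h : List.ofFn (fun i => u (Fin.cast (Nat.add_comm n m) i)) = List.ofFn u :=
    List.ext_getElem (by simp [add_comm]) fun k hk hk' => by simp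
  rw [mnBracket, mnCirc_eq_listCirc, mnCirc_eq_listCirc, h]
  rfl

end CochainLists

/-! ### Linearity of list cochains over multiplication operators -/

section ListLinear

variable {V : Type*} [AddCommGroup V] [Module ℝ V]

/-- `X` commutes with `T` in each list entry. -/
def ListLinear (T : Module.End ℝ V) (X : List V → Module.End ℝ V) : Prop :=
  ∀ p x l, X (p ++ T x :: l) = T * X (p ++ x :: l)

theorem ListLinear.cons {T : Module.End ℝ V} {X : List V → Module.End ℝ V} (h : ListLinear T X)
    (x : V) : ListLinear T (fun l => X (x :: l)) := fun p => h (x :: p)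

theorem ListLinear.head {T : Module.End ℝ V} {X : List V → Module.End ℝ V} (h : ListLinear T X)
    (x : V) (l : List V) : X (T x :: l) = T * X (x :: l) := h [] x l

theorem ListAlternating.move {W : Type*} [AddCommGroup W] [Module ℝ W] {Y : List V → W}
    (hY : ListAlternating Y) (p : List V) (x : V) (l : List V) :
    Y (p ++ x :: l) = (-1 : ℤ) ^ p.length • Y (x :: (p ++ l)) := by
  induction p generalizing Y with
  | nil => simp
  | cons z p ih =>
    have := ih (hY.cons z)
    simp only [List.cons_append] at this ⊢
    rw [this, hY.swap_cons z x, List.length_cons, pow_succ]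
    simp

/-- Antisymmetry moves any entry to the front at the cost of a sign. -/
theorem ListAlternating.listLinear_of_head {T : Module.End ℝ V} {Y : List V → Module.End ℝ V}
    (hY : ListAlternating Y) (h : ∀ x l, Y (T x :: l) = T * Y (x :: l)) : ListLinear T Y := by
  intro p x l
  rw [hY.move, hY.move p x l, h, mul_smul_comm]

theorem ListLinear.substSum_mul {T φ : Module.End ℝ V} {X : List V → Module.End ℝ V}
    (h : ListLinear T X) (b : List V) :
    substSum (T * φ) b X = T * substSum φ b X := by
  induction b generalizing X with
  | nil => simp [substSum]
  | cons x b ih =>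
    simp only [substSum, Module.End.mul_apply, mul_add, h.head]
    rw [ih (h.cons x)]

/-- Only the substitution in the last slot fails to commute with `T`, by a commutator. -/
theorem ListLinear.substEnd_mul {T : Module.End ℝ V} {X : List V → Module.End ℝ V}
    (h : ListLinear T X) (φ : Module.End ℝ V) (b : List V) :
    substEnd X b (T * φ) = T * substEnd X b φ + (X b * T - T * X b) * φ := by
  rw [substEnd, substEnd, h.substSum_mul]
  noncomm_ring

/-- The only defect comes from `φ` hitting `T x`; `hφ` lets its commutator with `T` leave `X`. -/
theorem ListLinear.substEnd_cons {T φ : Module.End ℝ V} {X : List V → Module.End ℝ V}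
    (hX : ListAlternating X) (h : ListLinear T X) (hφ : ListLinear (φ * T - T * φ) X)
    (x : V) (b : List V) :
    substEnd X (T x :: b) φ = T * substEnd X (x :: b) φ + (φ * T - T * φ) * X (x :: b) := by
  have e : φ (T x) = T (φ x) + (φ * T - T * φ) x := by simp
  have e₂ : (fun a => X (T x :: a)) = fun a => T * X (x :: a) := funext fun a => h.head x a
  have e₃ : substSum φ b (fun a => T * X (x :: a)) = T * substSum φ b (fun a => X (x :: a)) :=
    (map_substSum (AddMonoidHom.mulLeft T) φ b _).symm
  rw [substEnd, substEnd, substSum, substSum, e, hX.add_cons, h.head, h.head, hφ.head, e₂, e₃]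
  noncomm_ring

/-- The failure of linearity of `X ∘ D` in the first list entry. -/
theorem listCirc_cons_of_listLinear {T : Module.End ℝ V} {X D : List V → Module.End ℝ V}
    (hX : ListAlternating X) (hXT : ListLinear T X) (hDT : ListLinear T D)
    (hS : ∀ a, ListLinear (D a * T - T * D a) X) (x : V) (l : List V) :
    listCirc X D (T x :: l) = T * listCirc X D (x :: l) +
      shuffleSum l (fun a b => (X b * T - T * X b) * D (x :: a) +
        (-1 : ℤ) ^ a.length • ((D a * T - T * D a) * X (x :: b))) := by
  have hl : T * listCirc X D (x :: l) = shuffleSum l (fun a b => T * substEnd X b (D (x :: a))) +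
      shuffleSum l (fun a b => (-1 : ℤ) ^ a.length • (T * substEnd X (x :: b) (D a))) := by
    simp only [listCirc, shuffleSum, mul_add]
    congr 1
    · exact map_shuffleSum (AddMonoidHom.mulLeft T) l _
    · refine (map_shuffleSum (AddMonoidHom.mulLeft T) l _).trans ?_
      refine shuffleSum_congr l fun a b _ => ?_
      exact mul_smul_comm _ _ _
  rw [hl, ← shuffleSum_add, ← shuffleSum_add, listCirc, shuffleSum, ← shuffleSum_add]
  refine shuffleSum_congr l fun a b _ => ?_
  rw [hDT.head, hXT.substEnd_mul, ListLinear.substEnd_cons hX hXT (hS a), smul_add]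
  abel

/-- The defect of `X ∘ D` consists of a commutator of `X` times `D` and a commutator of `D` times
`X`. Exchanging the sublists turns it into `(-1)^{mn}` times the defect of `D ∘ X`, so the bracket
has none. In the application `T` is multiplication by a function and the commutators are such
multiplications again. -/
theorem ListLinear.listBracket {m n : ℕ} {T : Module.End ℝ V} {X D : List V → Module.End ℝ V}
    (hX : ListAlternating X) (hD : ListAlternating D)
    (hXm : ListHomogeneous m X) (hDn : ListHomogeneous n D)
    (hXT : ListLinear T X) (hDT : ListLinear T D)
    (hXS : ∀ a, ListLinear (D a * T - T * D a) X) (hDS : ∀ a, ListLinear (X a * T - T * X a) D) :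
    ListLinear T (listBracket m n X D) := by
  refine (hX.listBracket hD).listLinear_of_head fun x l => ?_
  rw [_root_.listBracket, _root_.listBracket, listCirc_cons_of_listLinear hX hXT hDT hXS,
    listCirc_cons_of_listLinear hD hDT hXT hDS]
  have key : shuffleSum l (fun a b => (X b * T - T * X b) * D (x :: a) +
        (-1 : ℤ) ^ a.length • ((D a * T - T * D a) * X (x :: b))) =
      (-1 : ℤ) ^ (m * n) • shuffleSum l (fun a b => (D b * T - T * D b) * X (x :: a) +
        (-1 : ℤ) ^ a.length • ((X a * T - T * X a) * D (x :: b))) := by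
    rw [shuffleSum_comm, ← shuffleSum_zsmul]
    refine shuffleSum_congr l fun a b _ => ?_
    rw [smul_add, smul_add, add_comm, smul_smul, smul_smul]
    congr 1
    · by_cases hb : b.length = n
      · by_cases ha : (x :: a).length = m
        · rw [← pow_add]
          congr 1
          rw [← ha, hb, List.length_cons, show a.length * n + n = (a.length + 1) * n by ring]
        · rw [hXm _ ha]; simp
      · rw [hDn _ hb]; simp
    · by_cases hb : (x :: b).length = n
      · by_cases ha : a.length = m
        · rw [← pow_add, ← hb, ha, List.length_cons, show m * (b.length + 1) + m =
            m * b.length + 2 * m by ring, pow_add _ _ (2 * m), pow_mul _ 2]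
          simp
        · rw [hXm _ ha]; simp
      · rw [hDn _ hb]; simp
  rw [key, mul_sub, mul_smul_comm, smul_add]
  abel

/-- The values of the bracket of two list cochains lie in every Lie subalgebra that contains the
values of the cochains. -/
theorem listBracket_mem {m n : ℕ} (𝓓 : Submodule ℝ (Module.End ℝ V))
    (h𝓓 : ∀ P ∈ 𝓓, ∀ Q ∈ 𝓓, P * Q - Q * P ∈ 𝓓) {X D : List V → Module.End ℝ V}
    (hXm : ListHomogeneous m X) (hDn : ListHomogeneous n D)
    (hX : ∀ l, X l ∈ 𝓓) (hD : ∀ l, D l ∈ 𝓓) (l : List V) : listBracket m n X D l ∈ 𝓓 := by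
  -- Substitutions in list entries only give values of `X` and `D`; the products from the last slot,
  -- which need not stay in `𝓓`, pair into commutators.
  have key : listBracket m n X D l = shuffleSum l (fun a b => substSum (D a) b X) -
      (-1 : ℤ) ^ (m * n) • shuffleSum l (fun a b => substSum (X a) b D) +
      shuffleSum l (fun a b => X b * D a - D a * X b) := by
    have h : (-1 : ℤ) ^ (m * n) • shuffleSum l (fun a b => D b * X a) =
        shuffleSum l (fun a b => D a * X b) := by
      rw [← shuffleSum_zsmul, shuffleSum_comm]
      refine shuffleSum_congr l fun a b _ => ?_
      by_cases ha : a.length = n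
      · by_cases hb : b.length = m
        · rw [ha, hb, smul_smul, mul_comm n m, ← pow_add, ← two_mul, pow_mul]
          simp
        · rw [hXm _ hb]; simp
      · rw [hDn _ ha]; simp
    have hc : ∀ X D : List V → Module.End ℝ V, listCirc X D l =
        shuffleSum l (fun a b => substSum (D a) b X) + shuffleSum l (fun a b => X b * D a) :=
      fun X D => shuffleSum_add l _ _
    rw [listBracket, hc, hc, smul_add, h, shuffleSum_sub]
    abel
  rw [key]
  exact add_mem (sub_mem (shuffleSum_mem 𝓓 l fun a b => substSum_mem 𝓓 _ b hX)
    (zsmul_mem (shuffleSum_mem 𝓓 l fun a b => substSum_mem 𝓓 _ b hD) _))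
    (shuffleSum_mem 𝓓 l fun a b => h𝓓 _ (hX b) _ (hD a))

theorem MNCochain.listLinear_onList {n : ℕ} {T : Module.End ℝ V} {D : MNCochain V n} :
    ListLinear T D.onList ↔ ∀ (u : Fin n → V) (i : Fin n) (v : V),
      D (Function.update u i (T (u i))) v = T (D u v) := by
  constructor
  · intro h u i v
    have h₁ := h ((List.ofFn u).take i) (u i) ((List.ofFn u).drop (i + 1))
    rw [← List.ofFn_update, ← List.ofFn_update, Function.update_eq_self, D.onList_ofFn,
      D.onList_ofFn] at h₁
    rw [h₁]
    rfl
  · intro h p x l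
    by_cases hl : n = (p ++ x :: l).length
    · have hp : p.length < n := by rw [hl]; simp
      have h₁ : n = (p ++ (T x) :: l).length := by rw [hl]; simp
      ext1 v
      have := h (fun i : Fin n => (p ++ x :: l).get (i.cast hl)) ⟨p.length, hp⟩ v
      rw [onList, onList, dif_pos h₁.symm, dif_pos hl.symm,
        List.get_append_cons_eq_update p x (T x) l hl h₁ hp, Module.End.mul_apply, ← this]
      simp
    · rw [onList, onList, dif_neg, dif_neg, mul_zero] <;>
      · intro h'
        apply hl
        rw [← h']
        try simp

end ListLinear

/-! ### Differential geometry of the bundle: frames, vector fields and symbols -/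

section Geometry

open VectorField Bundle

variable {B : Type*} [NormedAddCommGroup B] [NormedSpace ℝ B]
  {H : Type*} [TopologicalSpace H] {I : ModelWithCorners ℝ B H}
  {M : Type*} [TopologicalSpace M] [ChartedSpace H M] [IsManifold I ∞ M]

/-! ### Local frames cut off to global sections -/

section Frame

variable [FiniteDimensional ℝ B] [T2Space M]
  (F : Type*) [NormedAddCommGroup F] [NormedSpace ℝ F] [FiniteDimensional ℝ F]
  (E : M → Type*) [TopologicalSpace (Bundle.TotalSpace F E)] [∀ x, TopologicalSpace (E x)]
  [FiberBundle F E] [∀ x, AddCommGroup (E x)] [∀ x, Module ℝ (E x)] [VectorBundle ℝ F E]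
  [ContMDiffVectorBundle ∞ F E I]

/-- Near every point there is a frame of global sections, after cutting off. -/
theorem exists_cutoff_frame (x₀ : M) : ∃ (ι : Type) (_ : Fintype ι) (e : ι → Cₛ^∞⟮I; F, E⟯)
    (a : ι → ∀ x : M, E x →ₗ[ℝ] ℝ) (ρ : C^∞⟮I, M; 𝓘(ℝ, ℝ), ℝ⟯),
    (∀ᶠ x in nhds x₀, ρ x = 1) ∧
    (∀ (i : ι) (u : Cₛ^∞⟮I; F, E⟯), ContMDiff I 𝓘(ℝ, ℝ) ∞ (fun x => a i x (u x))) ∧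
    (∀ (x : M) (w : E x), ρ x • w = ∑ i, a i x w • e i x) ∧
    (∀ (i : ι) (w : E x₀),
      ContMDiffAt (I.prod 𝓘(ℝ, F)) 𝓘(ℝ, ℝ) ∞ (fun z : TotalSpace F E => a i z.1 z.2) ⟨x₀, w⟩) := by
  classical
  set t := trivializationAt F E x₀ with ht
  have hx₀ : x₀ ∈ t.baseSet := FiberBundle.mem_baseSet_trivializationAt F E x₀
  let b := Module.finBasis ℝ F
  obtain ⟨ψ, -, hψ⟩ := (SmoothBumpFunction.nhds_basis_tsupport (I := I) x₀).mem_iff.1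
    (t.open_baseSet.mem_nhds hx₀)
  have hs : ∀ i, ContMDiff I (I.prod 𝓘(ℝ, F)) ∞
      (fun x => TotalSpace.mk' F x (((ψ : M → ℝ) • t.localFrame b i : ∀ x, E x) x)) := fun i =>
    (ψ.contMDiff.contMDiffOn).smul_section_of_tsupport t.open_baseSet hψ
      (t.contMDiffOn_localFrame_baseSet ∞ b i)
  -- The bump function cuts off both the frame and its coefficients, making both global; hence `ρ`
  -- is its square.
  refine ⟨Fin (Module.finrank ℝ F), inferInstance, fun i => ⟨_, hs i⟩,
    fun i x => ψ x • t.localFrameCoeff I b i x,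
    ⟨fun x => ψ x * ψ x, ψ.contMDiff.mul ψ.contMDiff⟩, ?_, ?_, ?_, ?_⟩
  · filter_upwards [ψ.eventuallyEq_one] with x hx
    simp only [ContMDiffMap.coeFn_mk, hx]
    simp
  · intro i u
    refine contMDiff_of_tsupport fun x hx => ?_
    have hx' : x ∈ t.baseSet := hψ (tsupport_mul_subset_left hx)
    have := contMDiffAt_localFrameCoeff b (I := I) hx' (u.contMDiff x) i
    exact ψ.contMDiffAt.mul this
  · intro x w
    by_cases hx : x ∈ t.baseSet
    · have h := t.eq_sum_localFrameCoeff_smul (I := I) (b := b) (s := Function.update 0 x w) hx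
      simp only [Function.update_self] at h
      simp only [ContMDiffMap.coeFn_mk, ContMDiffSection.coeFn_mk]
      conv_lhs => rw [h]
      rw [Finset.smul_sum]
      refine Finset.sum_congr rfl fun i _ => ?_
      simp only [Pi.smul_apply', LinearMap.smul_apply, smul_smul, smul_eq_mul]
      congr 1
      ring
    · have h0 : ψ x = 0 := image_eq_zero_of_notMem_tsupport fun h => hx (hψ h)
      simp [h0]
  · intro i w
    have h₁ : ContMDiffAt (I.prod 𝓘(ℝ, F)) 𝓘(ℝ, ℝ) ∞
        (fun z : TotalSpace F E => b.repr (t z).2 i) ⟨x₀, w⟩ := by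
      have hz : (⟨x₀, w⟩ : TotalSpace F E) ∈ t.source := t.mem_source.2 hx₀
      have := ((t.contMDiffOn (IB := I) (n := ∞)) _ hz).contMDiffAt (t.open_source.mem_nhds hz)
      have h₂ : ContMDiffAt (I.prod 𝓘(ℝ, F)) 𝓘(ℝ, F) ∞ (fun z => (t z).2) ⟨x₀, w⟩ :=
        contMDiffAt_snd.comp _ this
      exact (LinearMap.toContinuousLinearMap (b.coord i)).contMDiff.contMDiffAt.comp _ h₂
    have h₃ : ContMDiffAt (I.prod 𝓘(ℝ, F)) 𝓘(ℝ, ℝ) ∞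
        (fun z : TotalSpace F E => ψ z.1 * b.repr (t z).2 i) ⟨x₀, w⟩ :=
      (ψ.contMDiff.contMDiffAt.comp _ (contMDiffAt_proj E)).mul h₁
    refine h₃.congr_of_eventuallyEq ?_
    have : t.source ∈ nhds (⟨x₀, w⟩ : TotalSpace F E) :=
      t.open_source.mem_nhds (t.mem_source.2 hx₀)
    filter_upwards [this] with z hz
    have hz' := t.mem_source.1 hz
    have := t.localFrameCoeff_eq_coeff (I := I) (b := b) (i := i)
      (s := Function.update 0 z.1 z.2) hz'
    simp only [Function.update_self] at this
    rw [LinearMap.smul_apply, smul_eq_mul, this]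

/-- Every vector of a smooth vector bundle is the value of a global section. -/
theorem exists_section_eq (x : M) (w : E x) : ∃ u : Cₛ^∞⟮I; F, E⟯, u x = w := by
  obtain ⟨ι, _, e, a, ρ, hρ, -, h, -⟩ := exists_cutoff_frame (I := I) F E x
  refine ⟨∑ i, a i x w • e i, ?_⟩
  have := h x w
  rw [hρ.self_of_nhds, one_smul] at this
  have hc := congrFun (map_sum (ContMDiffSection.coeAddHom I F ∞ E) (fun i => a i x w • e i)
    Finset.univ) x
  simp only [ContMDiffSection.coeAddHom_apply, Finset.sum_apply] at hc
  rw [hc]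
  exact this.symm

end Frame

/-! ### Vector fields as derivations -/

section LieBracketFunctions

theorem contMDiff_mvfderiv_apply (f : C^∞⟮I, M; 𝓘(ℝ, ℝ), ℝ⟯) {X : ∀ x : M, TangentSpace I x}
    (hX : ContMDiff I I.tangent ∞ (fun x => (⟨x, X x⟩ : TangentBundle I M))) :
    ContMDiff I 𝓘(ℝ, ℝ) ∞ (fun x => mvfderiv I f x (X x)) := by
  have h₁ : ContMDiff I.tangent (𝓘(ℝ, ℝ)).tangent ∞ (tangentMap I 𝓘(ℝ, ℝ) f) :=
    f.contMDiff.contMDiff_tangentMap le_rfl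
  exact (contMDiff_snd_tangentBundle_modelSpace ℝ 𝓘(ℝ, ℝ)).comp (h₁.comp hX)

variable [FiniteDimensional ℝ B]

theorem contMDiff_mlieBracket {X Y : ∀ x : M, TangentSpace I x}
    (hX : ContMDiff I I.tangent ∞ (fun x => (⟨x, X x⟩ : TangentBundle I M)))
    (hY : ContMDiff I I.tangent ∞ (fun x => (⟨x, Y x⟩ : TangentBundle I M))) :
    ContMDiff I I.tangent ∞ (fun x => (⟨x, mlieBracket I X Y x⟩ : TangentBundle I M)) := by
  have : CompleteSpace B := FiniteDimensional.complete ℝ B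
  have : IsManifold I (minSmoothness ℝ 2) M := by
    rw [minSmoothness_of_isRCLikeNormedField]
    infer_instance
  have : IsManifold I ((⊤ : ℕ∞) + 1) M := ‹IsManifold I ∞ M›
  exact ContDiff.mlieBracket_vectorField (m := ⊤) (n := ⊤) hX hY (by simp)

variable [T2Space M]

/-- The Lie bracket of vector fields acts on functions as the commutator. -/
theorem mvfderiv_mlieBracket (f : C^∞⟮I, M; 𝓘(ℝ, ℝ), ℝ⟯) {X Y : ∀ x : M, TangentSpace I x}
    (hX : ContMDiff I I.tangent ∞ (fun x => (⟨x, X x⟩ : TangentBundle I M)))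
    (hY : ContMDiff I I.tangent ∞ (fun x => (⟨x, Y x⟩ : TangentBundle I M))) (x : M) :
    mvfderiv I f x (mlieBracket I X Y x) =
      mvfderiv I (fun y => mvfderiv I f y (Y y)) x (X x) -
        mvfderiv I (fun y => mvfderiv I f y (X y)) x (Y x) := by
  have : CompleteSpace B := FiniteDimensional.complete ℝ B
  have : IsManifold I (minSmoothness ℝ 3) M := by
    rw [minSmoothness_of_isRCLikeNormedField]
    exact IsManifold.of_le (n := ∞) ENat.LEInfty.out
  by_cases hs : Subsingleton (TangentSpace I x)
  · rw [Subsingleton.elim (mlieBracket I X Y x) 0, Subsingleton.elim (X x) 0,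
      Subsingleton.elim (Y x) 0]
    simp
  rw [not_subsingleton_iff_nontrivial] at hs
  obtain ⟨w, hw⟩ := exists_ne (0 : TangentSpace I x)
  obtain ⟨W', rfl⟩ := exists_section_eq (I := I) B (TangentSpace I : M → Type _) x w
  set W : ∀ x : M, TangentSpace I x := fun x => W' x with hWdef
  have hW : ContMDiff I I.tangent ∞ (fun x => (⟨x, W x⟩ : TangentBundle I M)) := W'.contMDiff
  have d : ∀ {Z : ∀ x : M, TangentSpace I x},
      ContMDiff I I.tangent ∞ (fun x => (⟨x, Z x⟩ : TangentBundle I M)) → ∀ y,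
      MDifferentiableAt I I.tangent (fun x => (⟨x, Z x⟩ : TangentBundle I M)) y :=
    fun hZ y => (hZ y).mdifferentiableAt (by simp)
  have df : ∀ {g : M → ℝ}, ContMDiff I 𝓘(ℝ, ℝ) ∞ g → ∀ y, MDifferentiableAt I 𝓘(ℝ, ℝ) g y :=
    fun hg y => (hg y).mdifferentiableAt (by simp)
  -- Compare the Jacobi identity for `X`, `Y`, `f W` with `f` times the one for `X`, `Y`, `W`: what
  -- is left is the claimed identity multiplied by `W x`, which is nonzero.
  have hfW : ContMDiff I I.tangent ∞ (fun x => (⟨x, ((f : M → ℝ) • W) x⟩ : TangentBundle I M)) :=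
    f.contMDiff.smul_section hW
  have two : minSmoothness ℝ 2 ≤ (∞ : WithTop ℕ∞) := by
    rw [minSmoothness_of_isRCLikeNormedField]
    exact ENat.LEInfty.out
  have J := leibniz_identity_mlieBracket_apply ((hX x).of_le two) ((hY x).of_le two)
    ((hfW x).of_le two)
  have J' := leibniz_identity_mlieBracket_apply ((hX x).of_le two) ((hY x).of_le two)
    ((hW x).of_le two)
  have e : ∀ (Z : ∀ x : M, TangentSpace I x), mlieBracket I Z ((f : M → ℝ) • W) =
      (fun y => mvfderiv I f y (Z y)) • W + (f : M → ℝ) • mlieBracket I Z W := fun Z =>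
    funext fun y => mlieBracket_smul_right (df f.contMDiff y) (d hW y)
  have s : ∀ {Z Z' : ∀ x : M, TangentSpace I x},
      ContMDiff I I.tangent ∞ (fun x => (⟨x, Z x⟩ : TangentBundle I M)) →
      ContMDiff I I.tangent ∞ (fun x => (⟨x, Z' x⟩ : TangentBundle I M)) →
      mlieBracket I Z' (mlieBracket I Z ((f : M → ℝ) • W)) x =
        mvfderiv I (fun y => mvfderiv I f y (Z y)) x (Z' x) • W x +
        mvfderiv I f x (Z x) • mlieBracket I Z' W x + (mvfderiv I f x (Z' x) • mlieBracket I Z W x +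
        f x • mlieBracket I Z' (mlieBracket I Z W) x) := by
    intro Z Z' hZ hZ'
    have c₁ := contMDiff_mvfderiv_apply f hZ
    have c₂ := contMDiff_mlieBracket hZ hW
    rw [e Z, mlieBracket_add_right (d (c₁.smul_section hW) x) (d (f.contMDiff.smul_section c₂) x),
      mlieBracket_smul_right (df c₁ x) (d hW x),
      mlieBracket_smul_right (df f.contMDiff x) (d c₂ x)]
  rw [s hY hX, s hX hY, e] at J
  simp only [Pi.add_apply, Pi.smul_apply'] at J
  rw [J', smul_add] at J
  have key : (mvfderiv I f x (mlieBracket I X Y x) -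
      (mvfderiv I (fun y => mvfderiv I f y (Y y)) x (X x) -
        mvfderiv I (fun y => mvfderiv I f y (X y)) x (Y x))) • W x = 0 := by
    rw [sub_smul, sub_smul]
    rw [← sub_eq_zero] at J
    rw [← neg_eq_zero, ← J]
    abel
  rcases smul_eq_zero.1 key with h | h
  · exact sub_eq_zero.1 h
  · exact absurd h hw

/-- Tangent vectors are determined by their action on smooth functions. -/
theorem tangent_eq_of_mvfderiv_eq {x : M} {v w : TangentSpace I x}
    (h : ∀ f : C^∞⟮I, M; 𝓘(ℝ, ℝ), ℝ⟯, mvfderiv I f x v = mvfderiv I f x w) : v = w := by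
  obtain ⟨ψ⟩ : Nonempty (SmoothBumpFunction I x) := inferInstance
  -- The cut-off chart is global and has the invertible differential of the chart at `x`; composing
  -- it with functionals gives enough test functions.
  have hg : ContMDiff I 𝓘(ℝ, B) ∞ (fun y => ψ y • extChartAt I x y) :=
    ψ.contMDiff_smul contMDiffOn_extChartAt
  have hd : mfderiv I 𝓘(ℝ, B) (fun y => ψ y • extChartAt I x y) x =
      mfderiv I 𝓘(ℝ, B) (extChartAt I x) x := by
    refine Filter.EventuallyEq.mfderiv_eq ?_
    filter_upwards [ψ.eventuallyEq_one] with y hy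
    simp [hy]
  apply (isInvertible_mfderiv_extChartAt (mem_extChartAt_source (I := I) x)).injective
  rw [← hd]
  have hℓ : ∀ ℓ : B →L[ℝ] ℝ, ℓ (mfderiv I 𝓘(ℝ, B) (fun y => ψ y • extChartAt I x y) x v) =
      ℓ (mfderiv I 𝓘(ℝ, B) (fun y => ψ y • extChartAt I x y) x w) := by
    intro ℓ
    have hc : ∀ z, mvfderiv I (ℓ ∘ fun y => ψ y • extChartAt I x y) x z =
        ℓ (mfderiv I 𝓘(ℝ, B) (fun y => ψ y • extChartAt I x y) x z) := by
      intro z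
      have := mvfderiv_comp_apply (g := ℓ) x ℓ.mdifferentiableAt
        ((hg x).mdifferentiableAt (by simp)) z
      rw [this]
      change (mfderiv 𝓘(ℝ, B) 𝓘(ℝ, ℝ) ℓ _) _ = _
      rw [ContinuousLinearMap.mfderiv_eq]
      rfl
    have := h ⟨_, ℓ.contMDiff.comp hg⟩
    rw [← hc, ← hc]
    exact this
  exact (SeparatingDual.eq_iff_forall_dual_eq (R := ℝ) (V := B)).2 hℓ

end LieBracketFunctions

end Geometry

section Geometry

open VectorField Bundle

variable {B : Type*} [NormedAddCommGroup B] [NormedSpace ℝ B]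
  {H : Type*} [TopologicalSpace H] {I : ModelWithCorners ℝ B H}
  {M : Type*} [TopologicalSpace M] [ChartedSpace H M]
  {F : Type*} [NormedAddCommGroup F] [NormedSpace ℝ F]
  {E : M → Type*} [TopologicalSpace (Bundle.TotalSpace F E)] [∀ x, TopologicalSpace (E x)]
  [FiberBundle F E] [∀ x, AddCommGroup (E x)] [∀ x, Module ℝ (E x)] [VectorBundle ℝ F E]

/-! ### First-order operators on sections -/

theorem smooth_smul_apply (f : C^∞⟮I, M; 𝓘(ℝ, ℝ), ℝ⟯) (u : Cₛ^∞⟮I; F, E⟯) (x : M) :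
    (f • u) x = f x • u x := rfl

/-- Multiplication of sections by a smooth function. -/
def mulEnd (f : C^∞⟮I, M; 𝓘(ℝ, ℝ), ℝ⟯) : Module.End ℝ Cₛ^∞⟮I; F, E⟯ where
  toFun u := f • u
  map_add' u v := by
    ext x
    exact smul_add (f x) (u x) (v x)
  map_smul' c u := by
    ext x
    exact smul_comm (f x) c (u x)

theorem mulEnd_apply (f : C^∞⟮I, M; 𝓘(ℝ, ℝ), ℝ⟯) (u : Cₛ^∞⟮I; F, E⟯) : mulEnd f u = f • u := rfl

variable [IsManifold I ∞ M]

/-- `P` is a first-order operator on sections whose symbol is the smooth vector field `X`. -/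
structure HasSymbolField (P : Module.End ℝ Cₛ^∞⟮I; F, E⟯) (X : ∀ x : M, TangentSpace I x) :
    Prop where
  smooth : ContMDiff I I.tangent ∞ (fun x => (⟨x, X x⟩ : TangentBundle I M))
  leibniz : ∀ (f : C^∞⟮I, M; 𝓘(ℝ, ℝ), ℝ⟯) (v : Cₛ^∞⟮I; F, E⟯) (x : M),
    P (f • v) x = f x • P v x + mvfderiv I f x (X x) • v x

namespace HasSymbolField

variable {P Q : Module.End ℝ Cₛ^∞⟮I; F, E⟯} {X Y : ∀ x : M, TangentSpace I x}

theorem zero : HasSymbolField (0 : Module.End ℝ Cₛ^∞⟮I; F, E⟯) (fun _ => 0) :=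
  ⟨Bundle.contMDiff_zeroSection ℝ (TangentSpace I : M → Type _), fun f v x => by simp⟩

theorem add (hP : HasSymbolField P X) (hQ : HasSymbolField Q Y) :
    HasSymbolField (P + Q) (fun x => X x + Y x) := by
  refine ⟨hP.smooth.add_section hQ.smooth, fun f v x => ?_⟩
  simp only [LinearMap.add_apply, ContMDiffSection.coe_add, Pi.add_apply, hP.leibniz, hQ.leibniz,
    map_add, smul_add, add_smul]
  abel

theorem smul (c : ℝ) (hP : HasSymbolField P X) : HasSymbolField (c • P) (fun x => c • X x) := by
  refine ⟨hP.smooth.const_smul_section, fun f v x => ?_⟩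
  simp only [LinearMap.smul_apply, ContMDiffSection.coe_smul, Pi.smul_apply, hP.leibniz, map_smul,
    smul_add, smul_assoc]
  rw [smul_comm c (f x)]

theorem mulEnd_mul (f : C^∞⟮I, M; 𝓘(ℝ, ℝ), ℝ⟯) (hP : HasSymbolField P X) :
    HasSymbolField (mulEnd f * P) (fun x => f x • X x) := by
  refine ⟨f.contMDiff.smul_section hP.smooth, fun g v x => ?_⟩
  simp only [Module.End.mul_apply, mulEnd_apply, smooth_smul_apply, hP.leibniz, map_smul, smul_add,
    smul_assoc]
  rw [smul_comm (f x) (g x)]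

/-- The derivative of a function along the symbol, as a smooth function. -/
def deriv (hP : HasSymbolField P X) (f : C^∞⟮I, M; 𝓘(ℝ, ℝ), ℝ⟯) : C^∞⟮I, M; 𝓘(ℝ, ℝ), ℝ⟯ :=
  ⟨fun x => mvfderiv I f x (X x), contMDiff_mvfderiv_apply f hP.smooth⟩

theorem map_smul_eq (hP : HasSymbolField P X) (f : C^∞⟮I, M; 𝓘(ℝ, ℝ), ℝ⟯) (v : Cₛ^∞⟮I; F, E⟯) :
    P (f • v) = f • P v + hP.deriv f • v := by
  ext x
  exact hP.leibniz f v x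

/-- Commutators with functions have order zero, so multiderivations are linear over them; this
supplies the commutator hypotheses of `ListLinear.listBracket`. -/
theorem commutator_mulEnd (hP : HasSymbolField P X) (f : C^∞⟮I, M; 𝓘(ℝ, ℝ), ℝ⟯) :
    P * mulEnd f - mulEnd f * P = mulEnd (hP.deriv f) := by
  ext1 v
  simp only [LinearMap.sub_apply, Module.End.mul_apply, mulEnd_apply, hP.map_smul_eq]
  abel

/-- The mixed terms with one derivative on `f` and one operator on `v` cancel; the second
derivatives of `f` combine to the Lie bracket. -/
theorem commutator [FiniteDimensional ℝ B] [T2Space M] (hP : HasSymbolField P X)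
    (hQ : HasSymbolField Q Y) : HasSymbolField (P * Q - Q * P) (mlieBracket I X Y) := by
  refine ⟨contMDiff_mlieBracket hP.smooth hQ.smooth, fun f v x => ?_⟩
  simp only [LinearMap.sub_apply, Module.End.mul_apply, hP.map_smul_eq, hQ.map_smul_eq, map_add,
    ContMDiffSection.coe_add, ContMDiffSection.coe_sub, Pi.add_apply, Pi.sub_apply,
    smooth_smul_apply, mvfderiv_mlieBracket f hP.smooth hQ.smooth]
  change f x • P (Q v) x + mvfderiv I f x (X x) • Q v x + (mvfderiv I f x (Y x) • P v x +
    mvfderiv I (fun y => mvfderiv I f y (Y y)) x (X x) • v x) - (f x • Q (P v) x +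
    mvfderiv I f x (Y x) • P v x + (mvfderiv I f x (X x) • Q v x +
    mvfderiv I (fun y => mvfderiv I f y (X y)) x (Y x) • v x)) = _
  rw [smul_sub, sub_smul]
  abel

/-- Test the Leibniz rule on a section that does not vanish at `x`; this is why the fibre must be
nonzero. -/
theorem unique [FiniteDimensional ℝ B] [T2Space M] [FiniteDimensional ℝ F] [Nontrivial F]
    [ContMDiffVectorBundle ∞ F E I] (hX : HasSymbolField P X) (hY : HasSymbolField P Y) (x : M) :
    X x = Y x := by
  refine tangent_eq_of_mvfderiv_eq fun f => ?_
  have : Nontrivial (E x) :=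
    ((trivializationAt F E x).linearEquivAt ℝ x
      (FiberBundle.mem_baseSet_trivializationAt F E x)).toEquiv.nontrivial
  obtain ⟨w, hw⟩ := exists_ne (0 : E x)
  obtain ⟨u, rfl⟩ := exists_section_eq (I := I) F E x w
  have h := (hX.leibniz f u x).symm.trans (hY.leibniz f u x)
  have h' : (mvfderiv I f x (X x) - mvfderiv I f x (Y x)) • u x = 0 := by
    rw [sub_smul, sub_eq_zero]
    exact add_left_cancel h
  rcases smul_eq_zero.1 h' with h' | h'
  · exact sub_eq_zero.1 h'
  · exact absurd h' hw

end HasSymbolField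

variable (I F E) in
/-- The first-order operators on sections whose symbol is a smooth vector field. -/
def derivativeEnd : Submodule ℝ (Module.End ℝ Cₛ^∞⟮I; F, E⟯) where
  carrier := {P | ∃ X, HasSymbolField P X}
  zero_mem' := ⟨_, .zero⟩
  add_mem' := fun ⟨_, hP⟩ ⟨_, hQ⟩ => ⟨_, hP.add hQ⟩
  smul_mem' := fun c _ ⟨_, hP⟩ => ⟨_, hP.smul c⟩

theorem IsSymbol.hasSymbolField {n : ℕ} {D : MNCochain Cₛ^∞⟮I; F, E⟯ n}
    {σ : ∀ x : M, (E x) [⋀^Fin n]→ₗ[ℝ] TangentSpace I x} (h : IsSymbol I F E D σ)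
    (u : Fin n → Cₛ^∞⟮I; F, E⟯) : HasSymbolField (D u) (fun x => σ x (fun i => u i x)) :=
  ⟨h.smooth u, fun f v x => h.leibniz u v f x⟩

theorem isMultiderivation_listLinear {n : ℕ} {D : MNCochain Cₛ^∞⟮I; F, E⟯ n}
    (h : IsMultiderivation I F E D) (f : C^∞⟮I, M; 𝓘(ℝ, ℝ), ℝ⟯) : ListLinear (mulEnd f) D.onList :=
  MNCochain.listLinear_onList.2 fun u i v => h.map_smul u i f v

theorem isMultiderivation_onList_mem {n : ℕ} {D : MNCochain Cₛ^∞⟮I; F, E⟯ n}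
    (h : IsMultiderivation I F E D) (l : List Cₛ^∞⟮I; F, E⟯) :
    D.onList l ∈ derivativeEnd I F E := by
  obtain ⟨σ, hσ⟩ := h.exists_symbol
  by_cases hl : l.length = n
  · rw [MNCochain.onList, dif_pos hl]
    exact ⟨_, hσ.hasSymbolField _⟩
  · rw [D.onList_homogeneous l hl]
    exact zero_mem _

/-! ### Tensoriality -/

theorem subsingleton_fibre [Subsingleton F] (x : M) : Subsingleton (E x) :=
  ((trivializationAt F E x).linearEquivAt ℝ x
    (FiberBundle.mem_baseSet_trivializationAt F E x)).toEquiv.subsingleton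

variable [FiniteDimensional ℝ B] [T2Space M] [FiniteDimensional ℝ F]
  [ContMDiffVectorBundle ∞ F E I]

/-- An alternating map on sections that is linear over smooth functions at `x` factors through the
fibre at `x`. -/
theorem exists_fibre_factorization {W : Type*} [AddCommGroup W] [Module ℝ W] {n : ℕ} (x : M)
    (T : Cₛ^∞⟮I; F, E⟯ [⋀^Fin n]→ₗ[ℝ] W)
    (hT : ∀ (u : Fin n → Cₛ^∞⟮I; F, E⟯) (i : Fin n) (f : C^∞⟮I, M; 𝓘(ℝ, ℝ), ℝ⟯),
      T (Function.update u i (f • u i)) = f x • T u) :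
    ∃ σ : (E x) [⋀^Fin n]→ₗ[ℝ] W, ∀ u : Fin n → Cₛ^∞⟮I; F, E⟯, T u = σ (fun i => u i x) := by
  obtain ⟨ι, _, e, a, ρ, hρ, ha, h, -⟩ := exists_cutoff_frame (I := I) F E x
  have hρx := hρ.self_of_nhds
  have hT' : ∀ (u : Fin n → Cₛ^∞⟮I; F, E⟯) (i : Fin n) (f : C^∞⟮I, M; 𝓘(ℝ, ℝ), ℝ⟯)
      (v : Cₛ^∞⟮I; F, E⟯), T (Function.update u i (f • v)) = f x • T (Function.update u i v) := by
    intro u i f v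
    simpa using hT (Function.update u i v) i f
  have hsum : ∀ (s : ι → Cₛ^∞⟮I; F, E⟯) (y : M), (∑ j, s j) y = ∑ j, s j y := by
    intro s y
    have hc := congrFun (map_sum (ContMDiffSection.coeAddHom I F ∞ E) s Finset.univ) y
    simpa only [ContMDiffSection.coeAddHom_apply, Finset.sum_apply] using hc
  -- A linear extension of vectors at `x` to global sections; `key` shows that `T` does not
  -- distinguish `v` from the extension of `v x`, since `ρ • v` is a combination of the frame and `ρ
  -- x = 1`.
  let s : E x →ₗ[ℝ] Cₛ^∞⟮I; F, E⟯ := ∑ j, (a j x).smulRight (e j)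
  have key : ∀ (u : Fin n → Cₛ^∞⟮I; F, E⟯) (i : Fin n) (v : Cₛ^∞⟮I; F, E⟯),
      T (Function.update u i (s (v x))) = T (Function.update u i v) := by
    intro u i v
    let g : ι → C^∞⟮I, M; 𝓘(ℝ, ℝ), ℝ⟯ := fun j => ⟨fun y => a j y (v y), ha j v⟩
    have h₁ : ρ • v = ∑ j, g j • e j := by
      ext y
      rw [hsum]
      exact h y (v y)
    have h₂ := hT' u i ρ v
    rw [hρx, one_smul, h₁] at h₂
    have h₃ : s (v x) = ∑ j, a j x (v x) • e j := by simp [s]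
    rw [← h₂, h₃]
    have hlin := fun t : ι → Cₛ^∞⟮I; F, E⟯ =>
      map_sum (T.toMultilinearMap.toLinearMap u i) t Finset.univ
    simp only [MultilinearMap.toLinearMap_apply, AlternatingMap.coe_multilinearMap] at hlin
    rw [hlin, hlin]
    refine Finset.sum_congr rfl fun j _ => ?_
    rw [hT', T.map_update_smul]
    rfl
  refine ⟨T.compLinearMap s, fun u => ?_⟩
  have : ∀ S : Finset (Fin n), T (S.piecewise (fun i => s (u i x)) u) = T u := by
    intro S
    induction S using Finset.induction_on with
    | empty => simp
    | insert i S hi ih =>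
      rw [Finset.piecewise_insert, key, ← ih]
      congr 1
      conv_rhs => rw [← Function.update_eq_self i (S.piecewise (fun i => s (u i x)) u)]
      rw [Finset.piecewise_eq_of_notMem _ _ _ hi]
  have h₁ := this Finset.univ
  rw [Finset.piecewise_univ] at h₁
  rw [← h₁]
  rfl

/-- A cochain that is linear over smooth functions in its first arguments, and whose values are
first-order operators, is a multiderivation. -/
theorem isMultiderivation_of_mem {n : ℕ} {D : MNCochain Cₛ^∞⟮I; F, E⟯ n}
    (hl : ∀ f : C^∞⟮I, M; 𝓘(ℝ, ℝ), ℝ⟯, ListLinear (mulEnd f) D.onList)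
    (hD : ∀ u, D u ∈ derivativeEnd I F E) : IsMultiderivation I F E D := by
  have hl' : ∀ (u : Fin n → Cₛ^∞⟮I; F, E⟯) (i : Fin n) (f : C^∞⟮I, M; 𝓘(ℝ, ℝ), ℝ⟯)
      (v : Cₛ^∞⟮I; F, E⟯), D (Function.update u i (f • u i)) v = f • D u v :=
    fun u i f v => MNCochain.listLinear_onList.1 (hl f) u i v
  refine ⟨hl', ?_⟩
  -- In rank zero the operators do not determine a symbol, and zero is one. Otherwise uniqueness of
  -- the chosen `Z` makes it multilinear, alternating and tensorial in `u`.
  rcases subsingleton_or_nontrivial F with hF | hF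
  · refine ⟨fun x => 0, ?_, fun u v f x => ?_⟩
    · intro u
      exact Bundle.contMDiff_zeroSection ℝ (TangentSpace I : M → Type _)
    · have := subsingleton_fibre (F := F) (E := E) x
      exact Subsingleton.elim _ _
  choose Z hZ using hD
  have hZ' : ∀ {P Q : Module.End ℝ Cₛ^∞⟮I; F, E⟯} {X Y : ∀ x : M, TangentSpace I x} (x : M),
      P = Q → HasSymbolField P X → HasSymbolField Q Y → X x = Y x := by
    rintro P _ X Y x rfl hX hY
    exact hX.unique hY x
  let T : ∀ x : M, Cₛ^∞⟮I; F, E⟯ [⋀^Fin n]→ₗ[ℝ] TangentSpace I x := fun x =>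
    { toFun := fun u => Z u x
      map_update_add' := fun u i v w =>
        hZ' x (by simp only [D.map_update_add]) (hZ _) ((hZ _).add (hZ _))
      map_update_smul' := fun u i c v =>
        hZ' x (by simp only [D.map_update_smul]) (hZ _) ((hZ _).smul c)
      map_eq_zero_of_eq' := fun u i j h hij =>
        hZ' x (D.map_eq_zero_of_eq u h hij) (hZ _) .zero }
  have hT : ∀ x, ∃ σ : (E x) [⋀^Fin n]→ₗ[ℝ] TangentSpace I x, ∀ u : Fin n → Cₛ^∞⟮I; F, E⟯,
      T x u = σ (fun i => u i x) := fun x =>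
    exists_fibre_factorization x (T x) fun u i f =>
      hZ' x (LinearMap.ext fun v => hl' u i f v) (hZ _) ((hZ u).mulEnd_mul f)
  choose σ hσ using hT
  have hσ' : ∀ u, (fun x => σ x (fun i => u i x)) = Z u := fun u => funext fun x => (hσ x u).symm
  refine ⟨σ, fun u => ?_, fun u v f x => ?_⟩
  · have := (hZ u).smooth
    rw [← hσ' u] at this
    exact this
  · rw [← hσ x u]
    exact (hZ u).leibniz f v x

theorem isMultiderivation_mnBracketCochain {m n : ℕ} {D₁ : MNCochain Cₛ^∞⟮I; F, E⟯ m}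
    {D₂ : MNCochain Cₛ^∞⟮I; F, E⟯ n} (h₁ : IsMultiderivation I F E D₁)
    (h₂ : IsMultiderivation I F E D₂) : IsMultiderivation I F E (mnBracketCochain D₁ D₂) := by
  have hc : ∀ {m n : ℕ} {D₁ : MNCochain Cₛ^∞⟮I; F, E⟯ m} {D₂ : MNCochain Cₛ^∞⟮I; F, E⟯ n},
      IsMultiderivation I F E D₁ → IsMultiderivation I F E D₂ →
      ∀ (f : C^∞⟮I, M; 𝓘(ℝ, ℝ), ℝ⟯) (a : List Cₛ^∞⟮I; F, E⟯),
        ListLinear (D₁.onList a * mulEnd f - mulEnd f * D₁.onList a) D₂.onList := by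
    intro m n D₁ D₂ h₁ h₂ f a
    obtain ⟨X, hX⟩ := isMultiderivation_onList_mem h₁ a
    rw [hX.commutator_mulEnd]
    exact isMultiderivation_listLinear h₂ _
  refine isMultiderivation_of_mem (fun f => ?_) fun u => ?_
  · rw [onList_mnBracketCochain]
    exact ListLinear.listBracket D₁.onList_alternating D₂.onList_alternating D₁.onList_homogeneous
      D₂.onList_homogeneous (isMultiderivation_listLinear h₁ f) (isMultiderivation_listLinear h₂ f)
      (hc h₂ h₁ f) (hc h₁ h₂ f)
  · exact listBracket_mem (derivativeEnd I F E)
      (by rintro P ⟨X, hP⟩ Q ⟨Y, hQ⟩; exact ⟨_, hP.commutator hQ⟩) D₁.onList_homogeneous D₂.onList_homogeneous (isMultiderivation_onList_mem h₁)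
      (isMultiderivation_onList_mem h₂) _

end Geometry

/-- To verify the axioms of a graded Lie algebra, it suffices to do so after embedding every
homogeneous component into one fixed group. -/
def GradedLieStructure.ofInjective {L : ℕ → Type*} [∀ n, AddCommGroup (L n)] [∀ n, Module ℝ (L n)]
    {W : Type*} [AddCommGroup W] (ι : ∀ n, L n →+ W) (hι : ∀ n, Function.Injective (ι n))
    (bracket : ∀ m n : ℕ, L m →ₗ[ℝ] L n →ₗ[ℝ] L (m + n))
    (skew : ∀ (m n : ℕ) (x : L m) (y : L n), ι (m + n) (bracket m n x y) =
      -((-1 : ℤ) ^ (m * n) • ι (n + m) (bracket n m y x)))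
    (jacobi : ∀ (m n k : ℕ) (x : L m) (y : L n) (z : L k),
      ι (m + (n + k)) (bracket m (n + k) x (bracket n k y z)) =
        ι ((m + n) + k) (bracket (m + n) k (bracket m n x y) z) +
          (-1 : ℤ) ^ (m * n) • ι (n + (m + k)) (bracket n (m + k) y (bracket m k x z))) :
    GradedLieStructure L where
  bracket := bracket
  skew m n x y := by
    -- With the two degrees as variables, their equality can be substituted and injectivity used in
    -- a single degree.
    have key : ∀ {a b : ℕ} (_ : a = b) (c : ℤ) (x : L b) (y : L a), ι b x = -(c • ι a y) →
        DirectSum.of L b x = -(c • DirectSum.of L a y) := by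
      rintro a _ rfl c x y e
      rw [← map_zsmul, ← map_neg] at e ⊢
      rw [hι _ e]
    exact key (add_comm n m) _ _ _ (skew m n x y)
  jacobi m n k x y z := by
    have key : ∀ {a b d : ℕ} (_ : a = d) (_ : b = d) (c : ℤ) (x : L d) (y : L a) (z : L b),
        ι d x = ι a y + c • ι b z →
        DirectSum.of L d x = DirectSum.of L a y + c • DirectSum.of L b z := by
      rintro a _ _ rfl rfl c x y z e
      rw [← map_zsmul, ← map_add] at e ⊢
      rw [hι _ e]
    exact key (add_assoc m n k) (add_left_comm n m k) _ _ _ _ (jacobi m n k x y z)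

section Geometry

open VectorField Bundle

variable {B : Type*} [NormedAddCommGroup B] [NormedSpace ℝ B] [FiniteDimensional ℝ B]
  {H : Type*} [TopologicalSpace H] {I : ModelWithCorners ℝ B H}
  {M : Type*} [TopologicalSpace M] [ChartedSpace H M] [IsManifold I ∞ M] [T2Space M]
  {F : Type*} [NormedAddCommGroup F] [NormedSpace ℝ F] [FiniteDimensional ℝ F]
  {E : M → Type*} [TopologicalSpace (Bundle.TotalSpace F E)] [∀ x, TopologicalSpace (E x)]
  [FiberBundle F E] [∀ x, AddCommGroup (E x)] [∀ x, Module ℝ (E x)] [VectorBundle ℝ F E]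
  [ContMDiffVectorBundle ∞ F E I]

/-! ### The graded Lie algebra of multiderivations -/

/-- The Matsushima–Nijenhuis bracket of multiderivations. -/
def derBracket (m n : ℕ) (D₁ : Der I F E m) (D₂ : Der I F E n) : Der I F E (m + n) :=
  ⟨mnBracketCochain D₁.1 D₂.1, isMultiderivation_mnBracketCochain D₁.2 D₂.2⟩

theorem onList_derBracket {m n : ℕ} (D₁ : Der I F E m) (D₂ : Der I F E n) :
    (derBracket m n D₁ D₂).1.onList = listBracket m n D₁.1.onList D₂.1.onList :=
  onList_mnBracketCochain D₁.1 D₂.1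

omit [FiniteDimensional ℝ B] [T2Space M] [FiniteDimensional ℝ F]
  [ContMDiffVectorBundle ∞ F E I] in
theorem Der.ext_onList {n : ℕ} {D D' : Der I F E n} (h : D.1.onList = D'.1.onList) : D = D' :=
  Subtype.ext (MNCochain.onList_injective h)

variable (I F E) in
/-- The Matsushima–Nijenhuis bracket of multiderivations as a bilinear map. -/
def derBracketLinear (m n : ℕ) : Der I F E m →ₗ[ℝ] Der I F E n →ₗ[ℝ] Der I F E (m + n) :=
  LinearMap.mk₂ ℝ (derBracket m n)
    (fun D D' D₂ => Der.ext_onList <| by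
      rw [Submodule.coe_add, MNCochain.onList_add]
      simp only [onList_derBracket]
      rw [Submodule.coe_add, MNCochain.onList_add]
      exact funext (listBracket_add_left m n _ _ D₂.1.onList_alternating))
    (fun c D D₂ => Der.ext_onList <| by
      rw [Submodule.coe_smul, MNCochain.onList_smul]
      simp only [onList_derBracket]
      rw [Submodule.coe_smul, MNCochain.onList_smul]
      exact funext (listBracket_smul_left m n c _ D₂.1.onList_alternating))
    (fun D₁ D D' => Der.ext_onList <| by
      rw [Submodule.coe_add, MNCochain.onList_add]
      simp only [onList_derBracket]
      rw [Submodule.coe_add, MNCochain.onList_add]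
      exact funext (listBracket_add_right m n D₁.1.onList_alternating _ _))
    (fun c D₁ D => Der.ext_onList <| by
      rw [Submodule.coe_smul, MNCochain.onList_smul]
      simp only [onList_derBracket]
      rw [Submodule.coe_smul, MNCochain.onList_smul]
      exact funext (listBracket_smul_right m n c D₁.1.onList_alternating _))

variable (I F E) in
/-- Multiderivations of degree `n` as functions of lists of sections. -/
def Der.onListHom (n : ℕ) : Der I F E n →+ (List Cₛ^∞⟮I; F, E⟯ → Module.End ℝ Cₛ^∞⟮I; F, E⟯) where
  toFun D := D.1.onList
  map_zero' := funext fun l => by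
    have h := congrFun (MNCochain.onList_smul (0 : ℝ) (0 : MNCochain Cₛ^∞⟮I; F, E⟯ n)) l
    simpa using h
  map_add' D D' := MNCochain.onList_add D.1 D'.1

variable (I F E) in
/-- The graded Lie algebra of multiderivations. -/
def derGradedLie : GradedLieStructure (fun n : ℕ => Der I F E n) :=
  GradedLieStructure.ofInjective (Der.onListHom I F E) (fun _ _ _ h => Der.ext_onList h)
    (derBracketLinear I F E)
    (fun m n x y => by
      change (derBracket m n x y).1.onList = -((-1 : ℤ) ^ (m * n) • (derBracket n m y x).1.onList)
      rw [onList_derBracket, onList_derBracket]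
      exact funext (listBracket_skew m n _ _))
    (fun m n k x y z => by
      change (derBracket m (n + k) x (derBracket n k y z)).1.onList =
        (derBracket (m + n) k (derBracket m n x y) z).1.onList +
          (-1 : ℤ) ^ (m * n) • (derBracket n (m + k) y (derBracket m k x z)).1.onList
      simp only [onList_derBracket]
      exact funext (listBracket_jacobi x.1.onList_alternating y.1.onList_alternating
        z.1.onList_alternating x.1.onList_homogeneous y.1.onList_homogeneous
        z.1.onList_homogeneous))

/-! ### Left-symmetric algebroids -/

/-- A fibrewise linear map `E → TM` that sends smooth sections to smooth vector fields is smooth. -/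
theorem contMDiff_anchor (α : ∀ p : M, E p →ₗ[ℝ] TangentSpace I p)
    (hα : ∀ u : Cₛ^∞⟮I; F, E⟯,
      ContMDiff I I.tangent ∞ (fun x : M => (⟨x, α x (u x)⟩ : TangentBundle I M))) :
    ContMDiff (I.prod 𝓘(ℝ, F)) I.tangent ∞
      (fun e : Bundle.TotalSpace F E => (⟨e.1, α e.1 e.2⟩ : TangentBundle I M)) := by
  rintro ⟨x₀, w⟩
  obtain ⟨ι, _, e, a, ρ, hρ, -, h, ha⟩ := exists_cutoff_frame (I := I) F E x₀
  rw [contMDiffAt_totalSpace]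
  refine ⟨contMDiffAt_proj E, ?_⟩
  set t := trivializationAt B (TangentSpace I : M → Type _) x₀ with ht
  have hx₀ : x₀ ∈ t.baseSet := FiberBundle.mem_baseSet_trivializationAt B _ x₀
  have hp : ContMDiffAt (I.prod 𝓘(ℝ, F)) I ∞ (fun z : TotalSpace F E => z.1) ⟨x₀, w⟩ :=
    contMDiffAt_proj E
  -- Near `x₀` a vector is the combination of the frame with smooth coefficients, so its image is
  -- the same combination of the smooth vector fields `α (e i)`.
  have hs : ContMDiffAt (I.prod 𝓘(ℝ, F)) 𝓘(ℝ, B) ∞ (fun z : TotalSpace F E =>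
      ∑ i, a i z.1 z.2 • (t (⟨z.1, α z.1 (e i z.1)⟩ : TangentBundle I M)).2) ⟨x₀, w⟩ := by
    refine ContMDiffAt.sum fun i _ => (ha i w).smul ?_
    have h₁ := (contMDiffAt_totalSpace.1 (hα (e i) x₀)).2
    exact ContMDiffAt.comp (g := fun y => (t (⟨y, α y (e i y)⟩ : TangentBundle I M)).2)
      (⟨x₀, w⟩ : TotalSpace F E) h₁ hp
  refine hs.congr_of_eventuallyEq ?_
  have hnear : ∀ᶠ y in nhds x₀, y ∈ t.baseSet ∧ ρ y = 1 :=
    Filter.Eventually.and (t.open_baseSet.mem_nhds hx₀) hρ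
  filter_upwards [hp.continuousAt.eventually hnear] with z hz
  have hz' := h z.1 z.2
  rw [hz.2, one_smul] at hz'
  have hlin : ∀ v : TangentSpace I z.1, (t (⟨z.1, v⟩ : TangentBundle I M)).2 =
      t.linearMapAt ℝ z.1 v := fun v => by
    rw [t.linearMapAt_apply, if_pos hz.1]
  change (t (⟨z.1, α z.1 z.2⟩ : TangentBundle I M)).2 = _
  simp only [hlin]
  conv_lhs => rw [hz', map_sum, map_sum]
  simp only [map_smul]

/-- In degree one `-(-1)^{1·1} = 1`, so the bracket is `2 D ∘ D`: twice the difference of the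
associators of `(y, x, z)` and `(x, y, z)`. -/
theorem derBracket_one_one_eq_zero_iff (D : Der I F E 1) : derBracket 1 1 D D = 0 ↔
    ∀ x y z : Cₛ^∞⟮I; F, E⟯, D.1 ![x] (D.1 ![y] z) - D.1 ![D.1 ![x] y] z =
      D.1 ![y] (D.1 ![x] z) - D.1 ![D.1 ![y] x] z := by
  have hc : ∀ x y z : Cₛ^∞⟮I; F, E⟯, (derBracket 1 1 D D).1 ![x, y] z =
      (2 : ℝ) • ((D.1 ![y] (D.1 ![x] z) - D.1 ![D.1 ![y] x] z) -
        (D.1 ![x] (D.1 ![y] z) - D.1 ![D.1 ![x] y] z)) := by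
    intro x y z
    rw [← MNCochain.onList_ofFn, onList_derBracket, two_smul]
    have h₁ : ∀ x, D.1.onList [x] = D.1 ![x] := fun x => by
      rw [← MNCochain.onList_ofFn]; rfl
    have h₀ : D.1.onList [] = 0 := D.1.onList_homogeneous [] (by simp)
    have h₂ : ∀ x y, D.1.onList [x, y] = 0 := fun x y => D.1.onList_homogeneous _ (by simp)
    have hl : List.ofFn ![x, y] = [x, y] := rfl
    rw [hl]
    simp [listBracket, listCirc, shuffleSum, substEnd, substSum, h₁, h₀, h₂]
    abel
  constructor
  · intro h x y z
    have := hc x y z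
    rw [h] at this
    have h' := (smul_eq_zero.1 this.symm).resolve_left two_ne_zero
    exact (sub_eq_zero.1 h').symm
  · intro h
    refine Subtype.ext ?_
    ext1 u
    ext1 z
    have hu : u = ![u 0, u 1] := by
      ext1 i
      fin_cases i <;> rfl
    rw [hu, hc, h, sub_self, smul_zero]
    rfl

/-- Both compatibility conditions of an algebroid are already part of being in degree one of `Der`,
with the symbol as anchor; the bracket only decides left symmetry. -/
theorem exists_leftSymmetricAlgebroid_iff (D : Der I F E 1) :
    (∃ A : LeftSymmetricAlgebroid I F E, ∀ x y : Cₛ^∞⟮I; F, E⟯, A.mul x y = D.1 ![x] y) ↔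
      derBracket 1 1 D D = 0 := by
  rw [derBracket_one_one_eq_zero_iff]
  constructor
  · rintro ⟨A, hA⟩ x y z
    simpa only [hA] using A.left_symmetric x y z
  · intro h
    obtain ⟨σ, hσ⟩ := D.2.exists_symbol
    -- With a single argument the base point of the update is irrelevant, so `![0]` below is an
    -- arbitrary choice.
    have hv : ∀ {W : Type _} (x y : W), (![x] : Fin 1 → W) = Function.update ![y] 0 x :=
      fun x y => by ext1 i; fin_cases i; simp
    let mul : Cₛ^∞⟮I; F, E⟯ →ₗ[ℝ] Cₛ^∞⟮I; F, E⟯ →ₗ[ℝ] Cₛ^∞⟮I; F, E⟯ :=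
      D.1.toMultilinearMap.toLinearMap ![0] 0
    have hmul : ∀ x, mul x = D.1 ![x] := fun x => by
      change D.1 (Function.update ![0] 0 x) = _
      rw [← hv]
    let α : ∀ p : M, E p →ₗ[ℝ] TangentSpace I p :=
      fun p => (σ p).toMultilinearMap.toLinearMap ![0] 0
    have hα : ∀ (p : M) (x : E p), α p x = σ p (fun _ => x) := fun p x => by
      change σ p (Function.update ![0] 0 x) = _
      congr 1
      ext1 i
      fin_cases i
      simp
    have hα' : ∀ (p : M) (u : Cₛ^∞⟮I; F, E⟯), α p (u p) = σ p (fun i => (![u] : Fin 1 → _) i p) := by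
      intro p u
      rw [hα]
      congr 1
      ext1 i
      fin_cases i
      rfl
    refine ⟨⟨mul, fun x y z => ?_, α, contMDiff_anchor α fun u => ?_, fun f x y p => ?_,
      fun f x y => ?_⟩, fun x y => by rw [hmul]⟩
    · simp only [hmul]
      exact h x y z
    · simp only [hα']
      exact hσ.smooth ![u]
    · rw [hmul, hα']
      exact hσ.leibniz ![x] y f p
    · rw [hmul, hmul]
      have := D.2.map_smul ![x] 0 f y
      rw [← hv] at this
      exact this

end Geometry

end

theorem theorem5p4
    {B : Type*} [NormedAddCommGroup B] [NormedSpace ℝ B] [FiniteDimensional ℝ B]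
    {H : Type*} [TopologicalSpace H] (I : ModelWithCorners ℝ B H) [I.Boundaryless]
    {M : Type*} [TopologicalSpace M] [ChartedSpace H M] [IsManifold I ∞ M]
    [T2Space M] [SigmaCompactSpace M]
    (F : Type*) [NormedAddCommGroup F] [NormedSpace ℝ F] [FiniteDimensional ℝ F]
    (E : M → Type*) [TopologicalSpace (Bundle.TotalSpace F E)] [∀ x, TopologicalSpace (E x)]
    [FiberBundle F E] [∀ x, AddCommGroup (E x)] [∀ x, Module ℝ (E x)] [VectorBundle ℝ F E]
    [ContMDiffVectorBundle ∞ F E I] :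
    ∃ 𝔤 : GradedLieStructure (fun n : ℕ => Der I F E n),
      (∀ (m n : ℕ) (D₁ : Der I F E m) (D₂ : Der I F E n)
          (u : Fin (m + n) → Cₛ^∞⟮I; F, E⟯) (v : Cₛ^∞⟮I; F, E⟯),
        (𝔤.bracket m n D₁ D₂ : MNCochain Cₛ^∞⟮I; F, E⟯ (m + n)) u v =
          mnBracket (D₁ : MNCochain Cₛ^∞⟮I; F, E⟯ m) (D₂ : MNCochain Cₛ^∞⟮I; F, E⟯ n) u v) ∧
      ∀ π : Der I F E 1,
        (∃ A : LeftSymmetricAlgebroid I F E, ∀ x y : Cₛ^∞⟮I; F, E⟯,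
            A.mul x y = (π : MNCochain Cₛ^∞⟮I; F, E⟯ 1) ![x] y) ↔
          𝔤.bracket 1 1 π π = 0 :=
  ⟨derGradedLie I F E, fun _ _ D₁ D₂ u v => mnBracketCochain_apply D₁.1 D₂.1 u v,
    fun π => exists_leftSymmetricAlgebroid_iff π⟩
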